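/- Let $s\in(0,1)$ and $k>0$, and work in $\mathbb R^3$ with complex-valued fields. Assume (H): $\varepsilon_r\in C^\infty(\mathbb R^3)$ is real-valued, $\varepsilon_r=1$ outside a bounded domain $\Omega\subset\mathbb R^3$, and $\varepsilon_r\ge c$ on $\mathbb R^3$ for some constant $c>0$. Let $(-\Delta)^a f=\mathcal F^{-1}(|\xi|^{2a}\widehat f(\xi))$ for $a>-3/2$ and $I_\alpha=(-\Delta)^{-\alpha/2}$ (Riesz potential); these operators act componentwise on vector fields, and on distributions by duality. Let $$P_{2s-1}u:=-(-\Delta)^{s-1}\nabla\big(\nabla(\log\varepsilon_r)\cdot u\big).$$ For arbitrary $p,d\in\mathbb R^3$ let the projected incident field be $\widetilde E_i:=I_{1-s}\nabla\times\big(\nabla\times(p\,e^{ik^{1/s}x\cdot d})\big)$, that is, the distribution given by $$\langle\widetilde E_i,\varphi\rangle=\int_{\mathbb R^3}\big(\nabla\times(p\,e^{ik^{1/s}x\cdot d})\big)\cdot I_{1-s}(\nabla\times\varphi)\,dx,\qquad \varphi\in C_c^\infty(\mathbb R^3;\mathbb C^3).$$ Assume that $0$ is not a Dirichlet eigenvalue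 of $(-\Delta)^su=k^2\varepsilon_ru$ in $\mathbb R^3$, i.e. the only scalar $u\in H^s(\mathbb R^3)$ solving this equation is $u=0$. Then a field $\widetilde E_s\in H^s(\mathbb R^3;\mathbb C^3)$ solves $$I_{2-2s}\nabla\times\nabla\times\widetilde E_s-k^2\varepsilon_r\widetilde E_s=k^2(\varepsilon_r-1)\widetilde E_i\quad\text{in }\mathbb R^3$$ if and only if it solves $$(-\Delta)^s\widetilde E_s+P_{2s-1}\widetilde E_s-k^2\varepsilon_r\widetilde E_s=k^2(\varepsilon_r-1)\widetilde E_i-P_{2s-1}\widetilde E_i\quad\text{in }\mathbb R^3,$$ both equations being understood in the sense of tempered distributions. -/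

import Mathlib

open MeasureTheory FourierTransform
open scoped SchwartzMap ContDiff

noncomputable section

/-- Physical space `ℝ³`. -/
abbrev E3 : Type := EuclideanSpace ℝ (Fin 3)

/-- Complex scalar functions on `ℝ³`. -/
abbrev ScalarField : Type := E3 → ℂ

/-- Complex vector fields on `ℝ³` (one-point fields). -/
abbrev VecField : Type := E3 → Fin 3 → ℂ

/-- The partial derivative `∂_j f`. -/
def pderiv3 (j : Fin 3) (f : ScalarField) : ScalarField :=
  fun x => fderiv ℝ f x (EuclideanSpace.single j 1)

/-- `∇ · φ`. -/
def divField (φ : VecField) : ScalarField :=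
  fun x => ∑ j, pderiv3 j (fun y => φ y j) x

/-- `∇ × φ`. -/
def curlField (φ : VecField) : VecField := fun x =>
  ![pderiv3 1 (fun y => φ y 2) x - pderiv3 2 (fun y => φ y 1) x,
    pderiv3 2 (fun y => φ y 0) x - pderiv3 0 (fun y => φ y 2) x,
    pderiv3 0 (fun y => φ y 1) x - pderiv3 1 (fun y => φ y 0) x]

/-- The fractional Laplacian `(-Δ)^a f = 𝓕⁻¹ (|ξ|^{2a} 𝓕 f)` of a test function. Mathlib's Fourier
transform is `∫ e^{-2πi x·ξ} f(x) dx`, hence the factor `2π` in the symbol. For `-3/2 < a < 0` this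
is the Riesz potential (the value of the symbol at the single point `ξ = 0` is irrelevant). -/
def fracLaplacian (a : ℝ) (f : ScalarField) : ScalarField :=
  𝓕⁻ (fun ξ : E3 => (((2 * Real.pi * ‖ξ‖) ^ (2 * a) : ℝ) : ℂ) * 𝓕 f ξ)

/-- The Riesz potential `I_α = (-Δ)^{-α/2}` of a test function. -/
def rieszPotential (α : ℝ) (f : ScalarField) : ScalarField :=
  fracLaplacian (-(α / 2)) f

/-- The fractional Laplacian of a vector field, componentwise. -/
def fracLaplacianVec (a : ℝ) (φ : VecField) : VecField :=
  fun x i => fracLaplacian a (fun y => φ y i) x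

/-- The Riesz potential of a vector field, componentwise. -/
def rieszPotentialVec (α : ℝ) (φ : VecField) : VecField :=
  fun x i => rieszPotential α (fun y => φ y i) x

/-! ### Vector-valued distributions, given by their pairing `φ ↦ ⟨T, φ⟩` with vector fields -/

/-- The pairing `⟨T, ·⟩` of a vector-valued distribution `T`; the pairing is bilinear
(no complex conjugation). -/
abbrev VecPairing : Type := VecField → ℂ

/-- The distribution given by a vector field: `⟨u, φ⟩ = ∫ u · φ`. -/
def fieldPairing (u : VecField) : VecPairing :=
  fun φ => ∫ x, ∑ i, u x i * φ x i

/-- The product `m T` with a real scalar function: `⟨m T, φ⟩ = ⟨T, m φ⟩`. -/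
def mulDist (m : E3 → ℝ) (T : VecPairing) : VecPairing :=
  fun φ => T (fun x i => (m x : ℂ) * φ x i)

/-- `(-Δ)^s T`, by duality: `⟨(-Δ)^s T, φ⟩ = ⟨T, (-Δ)^s φ⟩`. -/
def fracLaplacianDist (s : ℝ) (T : VecPairing) : VecPairing :=
  fun φ => T (fracLaplacianVec s φ)

/-- `I_{2-2s} ∇ × ∇ × T`, by duality (the operator is symmetric):
`⟨I_{2-2s} ∇ × ∇ × T, φ⟩ = ⟨T, I_{2-2s} ∇ × ∇ × φ⟩`. -/
def rieszCurlCurlDist (s : ℝ) (T : VecPairing) : VecPairing :=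
  fun φ => T (rieszPotentialVec (2 - 2 * s) (curlField (curlField φ)))

/-- `P_{2s-1} T = - (-Δ)^{s-1} ∇ (∇ (log ε) · T)`, by duality. The gradient is minus the
transpose of the divergence and `(-Δ)^{s-1} = I_{2-2s}` is symmetric and commutes with derivatives,
so `⟨P_{2s-1} T, φ⟩ = ⟨∇ (log ε) · T, I_{2-2s} (∇ · φ)⟩ = ⟨T, (I_{2-2s} (∇ · φ)) ∇ (log ε)⟩`. -/
def lowerOrderDist (s : ℝ) (ε : E3 → ℝ) (T : VecPairing) : VecPairing :=
  fun φ => T (fun x i =>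
    ((fderiv ℝ (fun y => Real.log (ε y)) x (EuclideanSpace.single i 1) : ℝ) : ℂ) *
      rieszPotential (2 - 2 * s) (divField φ) x)

/-- The one-point fractional curl `Π 𝓒^* T = I_{1-s} ∇ × T`, by duality:
`⟨Π 𝓒^* T, φ⟩ = ⟨T, I_{1-s} ∇ × φ⟩`. -/
def piCurlStar (s : ℝ) (T : VecPairing) : VecPairing :=
  fun φ => T (rieszPotentialVec (1 - s) (curlField φ))

/-- The nonlocal plane wave `p e^{i k^{1/s} x·d}`. -/
def planeWave (s k : ℝ) (p d : E3) : VecField :=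
  fun x i => (p i : ℂ) * Complex.exp (Complex.I * ((k ^ (1 / s) * inner ℝ x d : ℝ) : ℂ))

/-- The projected incident field `Ẽ_i = Π 𝓒^* (∇ × (p e^{i k^{1/s} x·d}))`. -/
def incidentField (s k : ℝ) (p d : E3) : VecPairing :=
  piCurlStar s (fieldPairing (curlField (planeWave s k p d)))

/-! ### The assumptions and the equations -/

/-- Assumption (H) on the relative permittivity, with `Ω` a bounded domain. -/
structure AssumptionH (Ω : Set E3) (ε : E3 → ℝ) : Prop where
  isOpen : IsOpen Ω
  isConnected : IsConnected Ω
  isBounded : Bornology.IsBounded Ω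
  smooth : ContDiff ℝ ∞ ε
  eq_one : ∀ x, x ∉ Ω → ε x = 1
  lower_bound : ∃ c : ℝ, 0 < c ∧ ∀ x, c ≤ ε x

/-- `u ∈ L²` belongs to the Bessel potential space `H^s(ℝ³)`, `s ≥ 0`. -/
def MemHs (s : ℝ) (u : Lp ℂ 2 (volume : Measure E3)) : Prop :=
  TemperedDistribution.MemSobolev s 2 (u : 𝓢'(E3, ℂ))

/-- `0` is not a Dirichlet eigenvalue of `(-Δ)^s u = k² ε u` in `ℝ³`: the only solution
`u ∈ H^s(ℝ³)`, in the sense of tempered distributions, is `u = 0`. -/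
def ZeroNotDirichletEigenvalue (s k : ℝ) (ε : E3 → ℝ) : Prop :=
  ∀ u : Lp ℂ 2 (volume : Measure E3), MemHs s u →
    (∀ φ : 𝓢(E3, ℂ),
      ∫ x, u x * fracLaplacian s (φ : E3 → ℂ) x = (k : ℂ) ^ 2 * ∫ x, (ε x : ℂ) * u x * φ x) →
    u = 0

/-- The vector field with components `u 0, u 1, u 2`. -/
def fieldOf (u : Fin 3 → Lp ℂ 2 (volume : Measure E3)) : VecField :=
  fun x i => u i x

/-- The Schwartz test field with components `φ 0, φ 1, φ 2`. -/
def testField (φ : Fin 3 → 𝓢(E3, ℂ)) : VecField :=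
  fun x i => φ i x

/-- `Es` solves `I_{2-2s} ∇ × ∇ × Es - k² ε Es = k² (ε - 1) Ei` in `ℝ³`, in the sense of
tempered distributions. -/
def SolvesOnePoint (s k : ℝ) (ε : E3 → ℝ) (Es Ei : VecPairing) : Prop :=
  ∀ φ : Fin 3 → 𝓢(E3, ℂ),
    rieszCurlCurlDist s Es (testField φ) - (k : ℂ) ^ 2 * mulDist ε Es (testField φ) =
      (k : ℂ) ^ 2 * mulDist (fun x => ε x - 1) Ei (testField φ)

/-- `Es` solves `(-Δ)^s Es + P_{2s-1} Es - k² ε Es = k² (ε - 1) Ei - P_{2s-1} Ei` in `ℝ³`, in the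
sense of tempered distributions. -/
def SolvesFracLaplace (s k : ℝ) (ε : E3 → ℝ) (Es Ei : VecPairing) : Prop :=
  ∀ φ : Fin 3 → 𝓢(E3, ℂ),
    fracLaplacianDist s Es (testField φ) + lowerOrderDist s ε Es (testField φ)
        - (k : ℂ) ^ 2 * mulDist ε Es (testField φ) =
      (k : ℂ) ^ 2 * mulDist (fun x => ε x - 1) Ei (testField φ)
        - lowerOrderDist s ε Ei (testField φ)

end

noncomputable section

open scoped LineDeriv

/-! ### The inverse Fourier transform on `L¹ ∩ L²` -/

/-! Since $\nabla\times\nabla\times=\nabla\nabla\cdot-\Delta$, the operators $(-\Delta)^s$ and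
$I_{2-2s}\nabla\times\nabla\times$ differ by $-(-\Delta)^{s-1}\nabla\nabla\cdot$. The incident field
is divergence free, so the two equations differ exactly by the term $-(-\Delta)^{s-1}\nabla v$,
where $v=\nabla\cdot\widetilde E_s+\nabla(\log\varepsilon_r)\cdot(\widetilde E_s+\widetilde
E_i)=\varepsilon_r^{-1}\nabla\cdot\big(\varepsilon_r(\widetilde E_s+\widetilde E_i)\big)$. It
suffices that either equation forces $v=0$.

Testing with gradients takes the divergence. In the first equation the curl term disappears and
$k^2\varepsilon_rv=0$ remains, so $v=0$. In the second one $(-\Delta)^sv=k^2\varepsilon_rv$ remains,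
which is the eigenvalue equation; the spectral assumption gives $v=0$ once $v\in H^s$. A priori $v$
is only in $H^{-1}$. As $\varepsilon_r-1$ is a test function, multiplication by it preserves every
weighted $L^2$ space on the Fourier side, so each use of the equation gains $2s$ derivatives and a
bootstrap reaches $H^s$ (`WeightedL2.regularity`, `ae_eq_zero_of_zeroNotDirichletEigenvalue`).

The pairings are Lebesgue integrals, so they have to be shown to converge. The multiplier
$|\xi|^{2s-2}$ is singular at the origin, but it only meets divergences and curls, whose transforms
vanish there; at worst a pole of order below one is left, which is harmless in dimension three
(`VanishingDecay.fracSymbol_mul`). For the incident field, a plane wave is paired with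
$I_{1-s}\nabla\times\varphi$, which must therefore be in $L^1$ (`integrable_rieszPotential_curlS`).
Fourier inversion at the frequency of the wave then shows that $\widetilde E_i$ is itself a vector
multiple of the plane wave (`exists_incidentField_eq`). -/

theorem continuous_fourierInv_of_integrable {h : E3 → ℂ} (h1 : Integrable h) :
    Continuous (𝓕⁻ h) := by
  have : 𝓕⁻ h = fun x => 𝓕 h (-x) := by
    ext x; exact Real.fourierInv_eq_fourier_neg h x
  rw [this]
  have hc : Continuous (𝓕 h) :=
    VectorFourier.fourierIntegral_continuous Real.continuous_fourierChar
      (L := innerₗ E3) continuous_inner h1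
  exact hc.comp continuous_neg

theorem integral_fourierInv_mul_of_integrable {f g : E3 → ℂ} (hf : Integrable f)
    (hg : Integrable g) : ∫ x, f x * 𝓕⁻ g x = ∫ ξ, 𝓕⁻ f ξ * g ξ := by
  have key := VectorFourier.integral_fourierIntegral_smul_eq_flip (L := innerₗ E3)
    Real.continuous_fourierChar continuous_inner hf
    (g := fun x => g (-x)) hg.comp_neg
  have e1 : ∀ x, 𝓕⁻ g x = 𝓕 (fun x => g (-x)) x := fun x =>
    congrFun (Real.fourierInv_eq_fourier_comp_neg g) x
  have e2 : ∀ x, 𝓕⁻ f x = 𝓕 f (-x) := fun x => Real.fourierInv_eq_fourier_neg f x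
  have e3 : (innerₗ E3).flip = innerₗ E3 := by
    ext x y; simp
  rw [e3] at key
  calc ∫ x, f x * 𝓕⁻ g x = ∫ x, f x * 𝓕 (fun x => g (-x)) x := by simp_rw [e1]
    _ = ∫ ξ, 𝓕 f ξ * g (-ξ) := key.symm
    _ = ∫ ξ, 𝓕 f (-ξ) * g (- -ξ) := (integral_neg_eq_self (fun ξ => 𝓕 f ξ * g (-ξ)) volume).symm
    _ = ∫ ξ, 𝓕⁻ f ξ * g ξ := by simp_rw [e2, neg_neg]

/-- A locally integrable function that annihilates all Schwartz functions vanishes. -/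
theorem ae_eq_zero_of_integral_mul_schwartz {f : E3 → ℂ} (hf : LocallyIntegrable f)
    (h : ∀ ψ : 𝓢(E3, ℂ), ∫ x, f x * ψ x = 0) : f =ᵐ[volume] 0 := by
  apply ae_eq_zero_of_integral_contDiff_smul_eq_zero hf
  intro g g_smooth g_cpt
  have hg₁ : HasCompactSupport (Complex.ofRealCLM ∘ g) := g_cpt.comp_left rfl
  have hg₂ : ContDiff ℝ ∞ (Complex.ofRealCLM ∘ g) := by fun_prop
  rw [← h (hg₁.toSchwartzMap hg₂)]
  congr 1 with x
  simp [mul_comm]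

/-- The integral and the $L^2$ extension of the inverse transform define the same tempered
distribution, because both are moved onto the Schwartz function by duality. -/
theorem fourierInv_ae_eq_fourierInv_toLp {h : E3 → ℂ} (h1 : Integrable h) (h2 : MemLp h 2) :
    𝓕⁻ h =ᵐ[volume] ((𝓕⁻ (h2.toLp h) : Lp ℂ 2 (volume : Measure E3)) : E3 → ℂ) := by
  set H : Lp ℂ 2 (volume : Measure E3) := h2.toLp h
  have hc := continuous_fourierInv_of_integrable h1
  have hl : LocallyIntegrable ((𝓕⁻ H : Lp ℂ 2 (volume : Measure E3)) : E3 → ℂ) :=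
    (Lp.memLp (𝓕⁻ H)).locallyIntegrable (by norm_num)
  have := ae_eq_zero_of_integral_mul_schwartz (hc.locallyIntegrable.sub hl) ?_
  · filter_upwards [this] with x hx
    simpa [sub_eq_zero] using hx
  intro ψ
  have i1 : Integrable (fun x => 𝓕⁻ h x * ψ x) := by
    refine ψ.integrable.bdd_mul (c := ∫ ξ, ‖h ξ‖) hc.aestronglyMeasurable (.of_forall fun x => ?_)
    rw [Real.fourierInv_eq]
    refine (norm_integral_le_integral_norm _).trans (le_of_eq ?_)
    simp [Circle.norm_smul]
  have i2 : Integrable (fun x => (𝓕⁻ H : Lp ℂ 2 (volume : Measure E3)) x * ψ x) :=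
    (Lp.memLp (𝓕⁻ H)).integrable_mul (ψ.memLp 2)
  have e : (𝓕⁻ (H : 𝓢'(E3, ℂ))) ψ = ((𝓕⁻ H : Lp ℂ 2 (volume : Measure E3)) : 𝓢'(E3, ℂ)) ψ := by
    rw [Lp.fourierInv_toTemperedDistribution_eq]
  rw [TemperedDistribution.fourierInv_apply, Lp.toTemperedDistribution_apply,
    Lp.toTemperedDistribution_apply] at e
  simp only [Pi.sub_apply, sub_mul]
  rw [integral_sub i1 i2, sub_eq_zero]
  calc ∫ x, 𝓕⁻ h x * ψ x = ∫ x, ψ x * 𝓕⁻ h x := by simp_rw [mul_comm]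
    _ = ∫ x, 𝓕⁻ (ψ : E3 → ℂ) x * h x := integral_fourierInv_mul_of_integrable ψ.integrable h1
    _ = ∫ x, (𝓕⁻ ψ) x • H x := by
      apply integral_congr_ae
      filter_upwards [h2.coeFn_toLp] with x hx
      rw [hx, SchwartzMap.fourierInv_coe, smul_eq_mul]
    _ = _ := by rw [e]; simp_rw [smul_eq_mul, mul_comm]

theorem memLp_fourierInv {h : E3 → ℂ} (h1 : Integrable h) (h2 : MemLp h 2) :
    MemLp (𝓕⁻ h) 2 :=
  (memLp_congr_ae (fourierInv_ae_eq_fourierInv_toLp h1 h2)).2 (Lp.memLp _)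

/-- Both sides are continuous in `u`, and for Schwartz `u` the identity is the definition of the
transform of a tempered distribution; density concludes. -/
theorem integral_mul_fourierInv_Lp (u H : Lp ℂ 2 (volume : Measure E3)) :
    ∫ x, u x * (𝓕⁻ H : Lp ℂ 2 (volume : Measure E3)) x =
      ∫ ξ, (𝓕⁻ u : Lp ℂ 2 (volume : Measure E3)) ξ * H ξ := by
  have cont : ∀ F : Lp ℂ 2 (volume : Measure E3), Continuous fun u : Lp ℂ 2 (volume : Measure E3) =>
      ∫ x, u x * F x := by
    intro F
    have := (((ContinuousLinearMap.mul ℂ ℂ).lpPairing (volume : Measure E3) 2 2).flip F).continuous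
    convert this using 2 with u
    simp [ContinuousLinearMap.lpPairing_eq_integral]
  induction u using DenseRange.induction_on
    (SchwartzMap.denseRange_toLpCLM (E := E3) (F := ℂ) (p := 2) (μ := volume)
      ENNReal.ofNat_ne_top) with
  | hp =>
    exact isClosed_eq (cont _) ((cont _).comp (continuous_fourierInv))
  | ih ψ =>
    have e : (𝓕⁻ (H : 𝓢'(E3, ℂ))) ψ = ((𝓕⁻ H : Lp ℂ 2 (volume : Measure E3)) : 𝓢'(E3, ℂ)) ψ := by
      rw [Lp.fourierInv_toTemperedDistribution_eq]
    rw [TemperedDistribution.fourierInv_apply, Lp.toTemperedDistribution_apply,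
      Lp.toTemperedDistribution_apply] at e
    rw [SchwartzMap.toLpCLM_apply, SchwartzMap.toLp_fourierInv_eq]
    calc _ = ∫ x, ψ x • (𝓕⁻ H : Lp ℂ 2 (volume : Measure E3)) x := by
          apply integral_congr_ae
          filter_upwards [ψ.coeFn_toLp 2 volume] with x hx
          rw [hx, smul_eq_mul]
      _ = _ := by
          rw [← e]
          apply integral_congr_ae
          filter_upwards [(𝓕⁻ ψ).coeFn_toLp 2 volume] with x hx
          rw [hx, smul_eq_mul]

/-- Parseval's formula `∫ u 𝓕⁻h = ∫ (𝓕⁻u) h` for `u ∈ L²` and `h ∈ L¹ ∩ L²`. -/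
theorem integral_mul_fourierInv (u : Lp ℂ 2 (volume : Measure E3)) {h : E3 → ℂ}
    (h1 : Integrable h) (h2 : MemLp h 2) :
    ∫ x, u x * 𝓕⁻ h x = ∫ ξ, (𝓕⁻ u : Lp ℂ 2 (volume : Measure E3)) ξ * h ξ := by
  calc _ = ∫ x, u x * (𝓕⁻ (h2.toLp h) : Lp ℂ 2 (volume : Measure E3)) x := by
        apply integral_congr_ae
        filter_upwards [fourierInv_ae_eq_fourierInv_toLp h1 h2] with x hx
        rw [hx]
    _ = _ := integral_mul_fourierInv_Lp u _
    _ = _ := by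
        apply integral_congr_ae
        filter_upwards [h2.coeFn_toLp] with x hx
        rw [hx]

/-! ### Functions with at most a simple pole at the origin and rapid decay at infinity -/

/-- `|h(ξ)| ≤ C |ξ|⁻¹ (1 + |ξ|)⁻ⁿ` for all `n`. -/
structure RapidDecay (h : E3 → ℂ) : Prop where
  meas : AEStronglyMeasurable h
  bound : ∀ n : ℕ, ∃ C, ∀ ξ, ‖ξ‖ * (1 + ‖ξ‖) ^ n * ‖h ξ‖ ≤ C

/-- `|h(ξ)| ≤ C |ξ| (1 + |ξ|)⁻ⁿ` for all `n`. -/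
structure VanishingDecay (h : E3 → ℂ) : Prop where
  cont : Continuous h
  bound : ∀ n : ℕ, ∃ C, ∀ ξ, (1 + ‖ξ‖) ^ n * ‖h ξ‖ ≤ C * ‖ξ‖

/-- In polar coordinates the Jacobian $r^2$ of dimension three cancels the pole $|\xi|^{-2}$ and
leaves $(1+r)^{-2}$, integrable on the half-line. -/
theorem integrable_of_norm_sq_bound {f : E3 → ℂ} (hf : AEStronglyMeasurable f) {C : ℝ}
    (h : ∀ ξ, ‖ξ‖ ^ 2 * (1 + ‖ξ‖) ^ 2 * ‖f ξ‖ ≤ C) : Integrable f := by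
  have h0 : Integrable (fun ξ : E3 => (fun y : ℝ => C * ((y ^ 2)⁻¹ * ((1 + y) ^ 2)⁻¹)) ‖ξ‖) := by
    refine (integrable_fun_norm_addHaar (volume : Measure E3)
      (f := fun y : ℝ => C * ((y ^ 2)⁻¹ * ((1 + y) ^ 2)⁻¹))).2 ?_
    have e : Module.finrank ℝ E3 - 1 = 2 := by simp
    rw [e]
    have i1 : IntegrableOn (fun y : ℝ => |C| * (1 + y ^ 2)⁻¹) (Set.Ioi 0) :=
      (integrable_inv_one_add_sq.const_mul _).integrableOn
    refine Integrable.mono' i1 (by fun_prop) ?_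
    refine (ae_restrict_mem measurableSet_Ioi).mono fun y hy => ?_
    have hy : 0 < y := hy
    have : y ^ 2 • (C * ((y ^ 2)⁻¹ * ((1 + y) ^ 2)⁻¹)) = C * ((1 + y) ^ 2)⁻¹ := by
      rw [smul_eq_mul]; field_simp
    rw [this, norm_mul, Real.norm_eq_abs, Real.norm_eq_abs, abs_inv, abs_of_nonneg (sq_nonneg (1 + y))]
    gcongr
    nlinarith [show (0 : ℝ) < y from hy]
  refine h0.mono' hf ?_
  have : ∀ᵐ ξ : E3, ξ ≠ 0 := by simp [ae_iff, measure_singleton]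
  filter_upwards [this] with ξ hξ
  have hp : 0 < ‖ξ‖ := norm_pos_iff.2 hξ
  have := h ξ
  have h2 : ‖f ξ‖ = (‖ξ‖ ^ 2 * (1 + ‖ξ‖) ^ 2 * ‖f ξ‖) * ((‖ξ‖ ^ 2)⁻¹ * ((1 + ‖ξ‖) ^ 2)⁻¹) := by
    field_simp
  rw [h2]
  gcongr

theorem RapidDecay.integrable {h : E3 → ℂ} (hh : RapidDecay h) : Integrable h := by
  obtain ⟨C, hC⟩ := hh.bound 3
  refine integrable_of_norm_sq_bound hh.meas (C := C) fun ξ => (le_trans ?_ (hC ξ))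
  have : 0 ≤ ‖ξ‖ := norm_nonneg ξ
  gcongr ?_ * _
  calc ‖ξ‖ ^ 2 * (1 + ‖ξ‖) ^ 2 = ‖ξ‖ * (1 + ‖ξ‖) ^ 2 * ‖ξ‖ := by ring
    _ ≤ ‖ξ‖ * (1 + ‖ξ‖) ^ 2 * (1 + ‖ξ‖) := by gcongr; linarith
    _ = _ := by ring

/-- Squaring turns the simple pole into $|\xi|^{-2}$, still integrable near the origin of $\mathbb
R^3$. -/
theorem RapidDecay.memLp_two {h : E3 → ℂ} (hh : RapidDecay h) : MemLp h 2 := by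
  rw [memLp_two_iff_integrable_sq_norm hh.meas]
  obtain ⟨C, hC⟩ := hh.bound 1
  have : Integrable (fun ξ => ((‖h ξ‖ ^ 2 : ℝ) : ℂ)) := by
    refine integrable_of_norm_sq_bound ?_ (C := C ^ 2) fun ξ => ?_
    · exact Complex.continuous_ofReal.comp_aestronglyMeasurable (hh.meas.norm.pow 2)
    · have h1 := hC ξ
      have h0 : 0 ≤ ‖ξ‖ * (1 + ‖ξ‖) ^ 1 * ‖h ξ‖ := by positivity
      calc _ = (‖ξ‖ * (1 + ‖ξ‖) ^ 1 * ‖h ξ‖) ^ 2 := by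
            rw [Complex.norm_real, Real.norm_eq_abs, abs_of_nonneg (sq_nonneg _)]; ring
        _ ≤ _ := by gcongr
  exact_mod_cast this.re

theorem RapidDecay.mul_of_bound {h m : E3 → ℂ} (hh : RapidDecay h) (hm : AEStronglyMeasurable m)
    {K : ℝ} {N : ℕ} (hb : ∀ ξ, ‖m ξ‖ ≤ K * (1 + ‖ξ‖) ^ N) : RapidDecay (fun ξ => m ξ * h ξ) := by
  refine ⟨hm.mul hh.meas, fun n => ?_⟩
  obtain ⟨C, hC⟩ := hh.bound (n + N)
  have hK : 0 ≤ K := by simpa using (norm_nonneg _).trans (hb 0)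
  refine ⟨K * C, fun ξ => ?_⟩
  calc _ = ‖ξ‖ * (1 + ‖ξ‖) ^ n * (‖m ξ‖ * ‖h ξ‖) := by rw [norm_mul]
    _ ≤ ‖ξ‖ * (1 + ‖ξ‖) ^ n * ((K * (1 + ‖ξ‖) ^ N) * ‖h ξ‖) := by gcongr; exact hb ξ
    _ = K * (‖ξ‖ * (1 + ‖ξ‖) ^ (n + N) * ‖h ξ‖) := by ring
    _ ≤ _ := by gcongr; exact hC ξ

/-- The `j`-th Fourier symbol `2πi ξ_j` of the gradient. -/
def gradSymbol (j : Fin 3) (ξ : E3) : ℂ := 2 * Real.pi * Complex.I * (ξ j : ℂ)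

theorem continuous_gradSymbol (j : Fin 3) : Continuous (gradSymbol j) := by
  unfold gradSymbol; fun_prop

theorem norm_gradSymbol_le (j : Fin 3) (ξ : E3) : ‖gradSymbol j ξ‖ ≤ 2 * Real.pi * ‖ξ‖ := by
  have : ‖gradSymbol j ξ‖ = 2 * Real.pi * ‖ξ j‖ := by
    simp [gradSymbol, abs_of_pos Real.pi_pos]
  rw [this]
  gcongr
  exact PiLp.norm_apply_le ξ j

theorem RapidDecay.gradSymbol_mul {h : E3 → ℂ} (hh : RapidDecay h) (j : Fin 3) :
    RapidDecay (fun ξ => gradSymbol j ξ * h ξ) := by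
  refine hh.mul_of_bound (continuous_gradSymbol j).aestronglyMeasurable (K := 2 * Real.pi) (N := 1)
    fun ξ => (norm_gradSymbol_le j ξ).trans ?_
  have := Real.pi_pos
  gcongr
  linarith

theorem schwartz_one_add_norm_pow_bound (χ : 𝓢(E3, ℂ)) (n : ℕ) :
    ∃ C, ∀ ξ, (1 + ‖ξ‖) ^ n * ‖χ ξ‖ ≤ C := by
  refine ⟨2 ^ n * ((Finset.Iic (n, 0)).sup fun m => SchwartzMap.seminorm ℝ m.1 m.2) χ,
    fun ξ => ?_⟩
  have := SchwartzMap.one_add_le_sup_seminorm_apply (𝕜 := ℝ) (m := (n, 0)) (k := n) (n := 0) le_rfl le_rfl χ ξ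
  simpa using this

theorem rapidDecay_schwartz (χ : 𝓢(E3, ℂ)) : RapidDecay χ := by
  refine ⟨χ.continuous.aestronglyMeasurable, fun n => ?_⟩
  obtain ⟨C, hC⟩ := schwartz_one_add_norm_pow_bound χ (n + 1)
  refine ⟨C, fun ξ => le_trans ?_ (hC ξ)⟩
  have : 0 ≤ ‖ξ‖ := norm_nonneg ξ
  gcongr ?_ * _
  rw [pow_succ']
  gcongr
  linarith

theorem vanishingDecay_gradSymbol_mul (χ : 𝓢(E3, ℂ)) (j : Fin 3) :
    VanishingDecay (fun ξ => gradSymbol j ξ * χ ξ) := by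
  refine ⟨(continuous_gradSymbol j).mul χ.continuous, fun n => ?_⟩
  obtain ⟨C, hC⟩ := schwartz_one_add_norm_pow_bound χ n
  refine ⟨2 * Real.pi * C, fun ξ => ?_⟩
  have := Real.pi_pos
  calc _ = ‖gradSymbol j ξ‖ * ((1 + ‖ξ‖) ^ n * ‖χ ξ‖) := by rw [norm_mul]; ring
    _ ≤ (2 * Real.pi * ‖ξ‖) * C := by
      gcongr
      · exact norm_gradSymbol_le j ξ
      · exact hC ξ
    _ = _ := by ring

theorem VanishingDecay.add {f g : E3 → ℂ} (hf : VanishingDecay f) (hg : VanishingDecay g) :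
    VanishingDecay (fun ξ => f ξ + g ξ) := by
  refine ⟨hf.cont.add hg.cont, fun n => ?_⟩
  obtain ⟨C, hC⟩ := hf.bound n
  obtain ⟨D, hD⟩ := hg.bound n
  refine ⟨C + D, fun ξ => ?_⟩
  calc _ ≤ (1 + ‖ξ‖) ^ n * (‖f ξ‖ + ‖g ξ‖) := by gcongr; exact norm_add_le _ _
    _ ≤ _ := by linarith [hC ξ, hD ξ]

theorem VanishingDecay.neg {f : E3 → ℂ} (hf : VanishingDecay f) :
    VanishingDecay (fun ξ => - f ξ) :=
  ⟨hf.cont.neg, fun n => by simpa using hf.bound n⟩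

theorem VanishingDecay.sub {f g : E3 → ℂ} (hf : VanishingDecay f) (hg : VanishingDecay g) :
    VanishingDecay (fun ξ => f ξ - g ξ) := by
  simpa [sub_eq_add_neg] using hf.add hg.neg

/-! ### The symbol of the fractional Laplacian -/

/-- The symbol `(2π|ξ|)^{2a}` of `(-Δ)^a`. -/
def fracSymbol (a : ℝ) (ξ : E3) : ℂ := (((2 * Real.pi * ‖ξ‖) ^ (2 * a) : ℝ) : ℂ)

theorem norm_fracSymbol (a : ℝ) (ξ : E3) :
    ‖fracSymbol a ξ‖ = (2 * Real.pi * ‖ξ‖) ^ (2 * a) := by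
  have := Real.pi_pos
  rw [fracSymbol, Complex.norm_real, Real.norm_eq_abs, abs_of_nonneg (by positivity)]

theorem measurable_fracSymbol (a : ℝ) : Measurable (fracSymbol a) := by
  unfold fracSymbol; fun_prop

theorem fracSymbol_bound {a : ℝ} (h0 : 0 ≤ a) (h1 : a ≤ 1) (ξ : E3) :
    ‖fracSymbol a ξ‖ ≤ (2 * Real.pi) ^ 2 * (1 + ‖ξ‖) ^ 2 := by
  have := Real.pi_gt_three
  have hn := norm_nonneg ξ
  rw [norm_fracSymbol]
  calc _ ≤ (2 * Real.pi * (1 + ‖ξ‖)) ^ (2 * a) := by gcongr; linarith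
    _ ≤ (2 * Real.pi * (1 + ‖ξ‖)) ^ (2 : ℝ) := by
      apply Real.rpow_le_rpow_of_exponent_le
      · nlinarith
      · linarith
    _ = _ := by rw [Real.rpow_two]; ring

/-- At the origin both sides are zero: on the left because $s>0$, on the right because of the
quadratic factor, whatever the value there of the singular power. -/
theorem fracSymbol_eq {s : ℝ} (hs : 0 < s) (ξ : E3) :
    fracSymbol s ξ = fracSymbol (s - 1) ξ * ((2 * Real.pi * ‖ξ‖) ^ 2 : ℝ) := by
  have := Real.pi_pos
  unfold fracSymbol
  rcases eq_or_ne ξ 0 with rfl | hξ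
  · rw [norm_zero, mul_zero, Real.zero_rpow (by positivity)]; simp
  · have : 0 < ‖ξ‖ := norm_pos_iff.2 hξ
    rw [← Complex.ofReal_mul, ← Real.rpow_two, ← Real.rpow_add (by positivity)]
    ring_nf

theorem RapidDecay.fracSymbol_mul {a : ℝ} (h0 : 0 ≤ a) (h1 : a ≤ 1) {h : E3 → ℂ}
    (hh : RapidDecay h) : RapidDecay (fun ξ => fracSymbol a ξ * h ξ) :=
  hh.mul_of_bound (measurable_fracSymbol a).aestronglyMeasurable (fracSymbol_bound h0 h1)

/-- The first-order zero of `h` absorbs part of the singularity: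
$|\xi|\cdot|\xi|^{2a}\cdot|\xi|=|\xi|^{2(a+1)}$ has a nonnegative exponent and grows at most
quadratically. -/
theorem VanishingDecay.fracSymbol_mul {a : ℝ} (h0 : -1 < a) (h1 : a ≤ 0) {h : E3 → ℂ}
    (hh : VanishingDecay h) : RapidDecay (fun ξ => fracSymbol a ξ * h ξ) := by
  refine ⟨(measurable_fracSymbol a).aestronglyMeasurable.mul hh.cont.aestronglyMeasurable,
    fun n => ?_⟩
  -- The two additional powers pay for the quadratic growth of the symbol of order `a + 1`.
  obtain ⟨C, hC⟩ := hh.bound (n + 2)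
  have hp := Real.pi_gt_three
  refine ⟨(2 * Real.pi) ^ 2 * C, fun ξ => ?_⟩
  have e : ‖fracSymbol (a + 1) ξ‖ = ‖fracSymbol a ξ‖ * (2 * Real.pi * ‖ξ‖) ^ 2 := by
    rw [fracSymbol_eq (by linarith) ξ, norm_mul, Complex.norm_real, Real.norm_eq_abs,
      abs_of_nonneg (by positivity)]
    simp
  have hb := fracSymbol_bound (a := a + 1) (by linarith) (by linarith) ξ
  rcases eq_or_ne ξ 0 with rfl | hξ
  · have := hC 0
    simp at this
    simp
    -- The bound at the origin carries no information on the sign of `C`; a unit vector gives it.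
    have h2 := hC (EuclideanSpace.single 0 1)
    simp at h2
    have : 0 ≤ C := le_trans (by positivity) h2
    positivity
  have hx : 0 < ‖ξ‖ := norm_pos_iff.2 hξ
  rw [e] at hb
  have hC0 : 0 ≤ C := by
    have := (by positivity : 0 ≤ (1 + ‖ξ‖) ^ (n + 2) * ‖h ξ‖).trans (hC ξ)
    exact nonneg_of_mul_nonneg_left this hx
  calc _ = (‖ξ‖ * ‖fracSymbol a ξ‖) * ((1 + ‖ξ‖) ^ n * ‖h ξ‖) := by rw [norm_mul]; ring
    _ = (‖ξ‖ * ‖fracSymbol a ξ‖) * ((1 + ‖ξ‖) ^ (n + 2) * ‖h ξ‖) / (1 + ‖ξ‖) ^ 2 := by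
      rw [pow_add]; field_simp
    _ ≤ (‖ξ‖ * ‖fracSymbol a ξ‖) * (C * ‖ξ‖) / (1 + ‖ξ‖) ^ 2 := by
      gcongr ?_ * ?_ / _
      exact hC ξ
    _ = (‖fracSymbol a ξ‖ * (2 * Real.pi * ‖ξ‖) ^ 2) * C / (1 + ‖ξ‖) ^ 2 / (2 * Real.pi) ^ 2 := by
      field_simp
    _ ≤ ((2 * Real.pi) ^ 2 * (1 + ‖ξ‖) ^ 2) * C / (1 + ‖ξ‖) ^ 2 / (2 * Real.pi) ^ 2 := by
      gcongr
    _ = C := by field_simp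
    _ ≤ _ := by
      nlinarith [mul_nonneg hC0 (by nlinarith : (0:ℝ) ≤ (2 * Real.pi) ^ 2 - 1)]

/-! ### Vector calculus of Schwartz fields -/

/-- `∂_j ψ` of a Schwartz function. -/
def dS (j : Fin 3) (ψ : 𝓢(E3, ℂ)) : 𝓢(E3, ℂ) := ∂_{(EuclideanSpace.single j 1 : E3)} ψ

theorem dS_apply (j : Fin 3) (ψ : 𝓢(E3, ℂ)) (x : E3) :
    dS j ψ x = fderiv ℝ ψ x (EuclideanSpace.single j 1) :=
  SchwartzMap.lineDerivOp_apply_eq_fderiv _ ψ x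

theorem pderiv3_schwartz (j : Fin 3) (ψ : 𝓢(E3, ℂ)) : pderiv3 j (fun y => ψ y) = dS j ψ := by
  ext x; rw [dS_apply]; rfl

theorem fourier_dS (j : Fin 3) (ψ : 𝓢(E3, ℂ)) (ξ : E3) :
    𝓕 (dS j ψ) ξ = gradSymbol j ξ * 𝓕 ψ ξ := by
  rw [dS, SchwartzMap.fourier_lineDerivOp_eq, smul_apply,
    SchwartzMap.smulLeftCLM_apply_apply (by fun_prop)]
  simp [gradSymbol, EuclideanSpace.inner_single_right, mul_assoc]

theorem schwartz_ext_fourier {f g : 𝓢(E3, ℂ)} (h : ∀ ξ, 𝓕 f ξ = 𝓕 g ξ) : f = g := by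
  have : 𝓕 f = 𝓕 g := SchwartzMap.ext h
  rw [← fourierInv_fourier_eq (F := 𝓢(E3, ℂ)) f, this, fourierInv_fourier_eq]

/-- `∇ψ`. -/
def gradS (ψ : 𝓢(E3, ℂ)) : Fin 3 → 𝓢(E3, ℂ) := fun j => dS j ψ

/-- `∇·φ`. -/
def divS (φ : Fin 3 → 𝓢(E3, ℂ)) : 𝓢(E3, ℂ) := dS 0 (φ 0) + dS 1 (φ 1) + dS 2 (φ 2)

/-- `∇×φ`. -/
def curlS (φ : Fin 3 → 𝓢(E3, ℂ)) : Fin 3 → 𝓢(E3, ℂ) :=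
  ![dS 1 (φ 2) - dS 2 (φ 1), dS 2 (φ 0) - dS 0 (φ 2), dS 0 (φ 1) - dS 1 (φ 0)]

theorem divField_testField (φ : Fin 3 → 𝓢(E3, ℂ)) : divField (testField φ) = divS φ := by
  ext x
  simp [divField, testField, Fin.sum_univ_three, divS, pderiv3_schwartz]

theorem curlField_testField (φ : Fin 3 → 𝓢(E3, ℂ)) :
    curlField (testField φ) = testField (curlS φ) := by
  ext x i
  fin_cases i <;> simp [curlField, testField, curlS, pderiv3_schwartz]

theorem fourier_sub_apply (f g : 𝓢(E3, ℂ)) (ξ : E3) : 𝓕 (f - g) ξ = 𝓕 f ξ - 𝓕 g ξ := by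
  rw [sub_eq_add_neg, FourierTransform.fourier_add, FourierTransform.fourier_neg, ← sub_eq_add_neg]; rfl

theorem fourier_add_apply (f g : 𝓢(E3, ℂ)) (ξ : E3) : 𝓕 (f + g) ξ = 𝓕 f ξ + 𝓕 g ξ := by
  rw [FourierTransform.fourier_add]; rfl

theorem fourier_divS (φ : Fin 3 → 𝓢(E3, ℂ)) (ξ : E3) :
    𝓕 (divS φ) ξ = gradSymbol 0 ξ * 𝓕 (φ 0) ξ + gradSymbol 1 ξ * 𝓕 (φ 1) ξ
      + gradSymbol 2 ξ * 𝓕 (φ 2) ξ := by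
  simp only [divS, fourier_add_apply, fourier_dS]

theorem fourier_curlS (φ : Fin 3 → 𝓢(E3, ℂ)) (i : Fin 3) (ξ : E3) :
    𝓕 (curlS φ i) ξ =
      ![gradSymbol 1 ξ * 𝓕 (φ 2) ξ - gradSymbol 2 ξ * 𝓕 (φ 1) ξ,
        gradSymbol 2 ξ * 𝓕 (φ 0) ξ - gradSymbol 0 ξ * 𝓕 (φ 2) ξ,
        gradSymbol 0 ξ * 𝓕 (φ 1) ξ - gradSymbol 1 ξ * 𝓕 (φ 0) ξ] i := by
  fin_cases i <;> simp [curlS, fourier_sub_apply, fourier_dS]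

theorem curlS_gradS (ψ : 𝓢(E3, ℂ)) : curlS (gradS ψ) = 0 := by
  ext1 i
  refine schwartz_ext_fourier fun ξ => ?_
  rw [fourier_curlS, Pi.zero_apply, FourierTransform.fourier_zero]
  fin_cases i <;> simp [gradS, fourier_dS] <;> ring

theorem gradSymbol_sq_sum (ξ : E3) :
    gradSymbol 0 ξ ^ 2 + gradSymbol 1 ξ ^ 2 + gradSymbol 2 ξ ^ 2
      = -(((2 * Real.pi * ‖ξ‖) ^ 2 : ℝ) : ℂ) := by
  have : ‖ξ‖ ^ 2 = ξ 0 ^ 2 + ξ 1 ^ 2 + ξ 2 ^ 2 := by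
    rw [EuclideanSpace.norm_sq_eq]; simp [Fin.sum_univ_three]
  rw [mul_pow, this]
  simp only [gradSymbol, mul_pow, Complex.I_sq]
  push_cast
  ring

/-- This is $-\Delta-\nabla\times\nabla\times=-\nabla\nabla\cdot$, multiplied by the symbol of
$(-\Delta)^{s-1}$. -/
theorem fracSymbol_curl_curl {s : ℝ} (hs : 0 < s) (φ : Fin 3 → 𝓢(E3, ℂ)) (i : Fin 3) (ξ : E3) :
    fracSymbol s ξ * 𝓕 (φ i) ξ - fracSymbol (s - 1) ξ * 𝓕 (curlS (curlS φ) i) ξ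
      = -(gradSymbol i ξ * (fracSymbol (s - 1) ξ * 𝓕 (divS φ) ξ)) := by
  rw [fracSymbol_eq hs]
  have h := gradSymbol_sq_sum ξ
  have h' : (((2 * Real.pi * ‖ξ‖) ^ 2 : ℝ) : ℂ) =
    -(gradSymbol 0 ξ ^ 2 + gradSymbol 1 ξ ^ 2 + gradSymbol 2 ξ ^ 2) := by rw [h, neg_neg]
  rw [h', fourier_divS, fourier_curlS]
  fin_cases i <;> simp [fourier_curlS] <;> ring

theorem fracLaplacian_eq (a : ℝ) (ψ : 𝓢(E3, ℂ)) :
    fracLaplacian a ψ = 𝓕⁻ (fun ξ => fracSymbol a ξ * 𝓕 ψ ξ) := rfl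

theorem rapidDecay_fracSymbol_fourier {s : ℝ} (hs0 : 0 ≤ s) (hs1 : s ≤ 1) (ψ : 𝓢(E3, ℂ)) :
    RapidDecay (fun ξ => fracSymbol s ξ * 𝓕 ψ ξ) :=
  (rapidDecay_schwartz (𝓕 ψ)).fracSymbol_mul hs0 hs1

theorem vanishingDecay_fourier_divS (φ : Fin 3 → 𝓢(E3, ℂ)) :
    VanishingDecay (fun ξ => 𝓕 (divS φ) ξ) := by
  simp only [fourier_divS]
  exact ((vanishingDecay_gradSymbol_mul _ 0).add (vanishingDecay_gradSymbol_mul _ 1)).add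
    (vanishingDecay_gradSymbol_mul _ 2)

theorem vanishingDecay_fourier_curlS (φ : Fin 3 → 𝓢(E3, ℂ)) (i : Fin 3) :
    VanishingDecay (fun ξ => 𝓕 (curlS φ i) ξ) := by
  simp only [fourier_curlS]
  fin_cases i <;>
  exact (vanishingDecay_gradSymbol_mul _ _).sub (vanishingDecay_gradSymbol_mul _ _)

/-! ### `L¹` bounds for dilated Fourier multipliers -/

/-- The function with Fourier transform `ξ ↦ μ(rξ)`. -/
def dilatedKernel (μ : 𝓢(E3, ℂ)) (r : ℝ) (hr : r ≠ 0) : 𝓢(E3, ℂ) :=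
  ((|r ^ 3|⁻¹ : ℝ) : ℂ) • SchwartzMap.compCLMOfContinuousLinearEquiv ℂ
    (ContinuousLinearEquiv.smulLeft (Units.mk0 r⁻¹ (inv_ne_zero hr)) : E3 ≃L[ℝ] E3) (𝓕⁻ μ)

theorem dilatedKernel_apply (μ : 𝓢(E3, ℂ)) {r : ℝ} (hr : r ≠ 0) (x : E3) :
    dilatedKernel μ r hr x = ((|r ^ 3|⁻¹ : ℝ) : ℂ) * 𝓕⁻ μ (r⁻¹ • x) := rfl

theorem fourier_dilatedKernel (μ : 𝓢(E3, ℂ)) {r : ℝ} (hr : r ≠ 0) (ξ : E3) :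
    𝓕 (dilatedKernel μ r hr) ξ = μ (r • ξ) := by
  have h3 : |r ^ 3| ≠ 0 := by positivity
  rw [SchwartzMap.fourier_coe, Real.fourier_eq]
  have e : ∀ v : E3, Real.fourierChar (-inner ℝ v ξ) • dilatedKernel μ r hr v =
      (fun y : E3 => ((|r ^ 3|⁻¹ : ℝ) : ℂ) *
        (Real.fourierChar (-inner ℝ y (r • ξ)) • 𝓕⁻ μ y)) (r⁻¹ • v) := by
    intro v
    simp only [dilatedKernel_apply]
    rw [inner_smul_left, inner_smul_right]
    simp only [Circle.smul_def, smul_eq_mul, RCLike.conj_to_real]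
    rw [← mul_assoc r⁻¹, inv_mul_cancel₀ hr, one_mul]
    ring
  refine ((integral_congr_ae (.of_forall e)).trans (Measure.integral_comp_inv_smul volume
    (fun y : E3 => ((|r ^ 3|⁻¹ : ℝ) : ℂ) * (Real.fourierChar (-inner ℝ y (r • ξ)) • 𝓕⁻ μ y))
    r)).trans ?_
  rw [integral_const_mul, finrank_euclideanSpace_fin, ← Real.fourier_eq, ← SchwartzMap.fourier_coe, fourier_fourierInv_eq, Complex.real_smul,
    ← mul_assoc, ← Complex.ofReal_mul, mul_inv_cancel₀ h3, Complex.ofReal_one, one_mul]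

/-- Dilation with this normalisation preserves the $L^1$ norm, which makes the multiplier bounds
below uniform in `r`. -/
theorem lintegral_dilatedKernel (μ : 𝓢(E3, ℂ)) {r : ℝ} (hr : r ≠ 0) :
    ∫⁻ x, ‖dilatedKernel μ r hr x‖ₑ = ENNReal.ofReal (∫ x, ‖𝓕⁻ μ x‖) := by
  have h3 : |r ^ 3| ≠ 0 := by positivity
  rw [← ofReal_integral_norm_eq_lintegral_enorm (dilatedKernel μ r hr).integrable]
  congr 1
  have e : ∀ v : E3, ‖dilatedKernel μ r hr v‖ =
      (fun y : E3 => |r ^ 3|⁻¹ * ‖𝓕⁻ μ y‖) (r⁻¹ • v) := by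
    intro v
    rw [dilatedKernel_apply, norm_mul, Complex.norm_real, Real.norm_eq_abs, abs_inv, abs_abs]
  refine ((integral_congr_ae (.of_forall e)).trans (Measure.integral_comp_inv_smul volume
    (fun y : E3 => |r ^ 3|⁻¹ * ‖𝓕⁻ μ y‖) r)).trans ?_
  rw [integral_const_mul, finrank_euclideanSpace_fin, smul_eq_mul,
    ← mul_assoc, mul_inv_cancel₀ h3, one_mul]

theorem lintegral_convolution_le (N ψ : 𝓢(E3, ℂ)) :
    ∫⁻ x, ‖SchwartzMap.convolution (ContinuousLinearMap.mul ℂ ℂ) N ψ x‖ₑ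
      ≤ (∫⁻ x, ‖N x‖ₑ) * ∫⁻ x, ‖ψ x‖ₑ := by
  have hm : Measurable (Function.uncurry fun (x t : E3) => ‖N t‖ₑ * ‖ψ (x - t)‖ₑ) := by
    have := N.continuous
    have := ψ.continuous
    unfold Function.uncurry
    fun_prop
  calc _ ≤ ∫⁻ x, ∫⁻ t, ‖N t‖ₑ * ‖ψ (x - t)‖ₑ := by
        gcongr with x
        rw [SchwartzMap.convolution_apply, convolution_def]
        refine (enorm_integral_le_lintegral_enorm _).trans (le_of_eq ?_)
        simp [enorm_mul]
    _ = ∫⁻ t, ∫⁻ x, ‖N t‖ₑ * ‖ψ (x - t)‖ₑ := lintegral_lintegral_swap hm.aemeasurable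
    _ = ∫⁻ t, ‖N t‖ₑ * ∫⁻ x, ‖ψ x‖ₑ := by
        congr with t
        rw [lintegral_const_mul (f := fun x => ‖ψ (x - t)‖ₑ) _
            (ψ.continuous.comp (continuous_sub_right t)).enorm.measurable,
          lintegral_sub_right_eq_self (fun x => ‖ψ x‖ₑ) t]
    _ = _ := by rw [lintegral_mul_const _ N.continuous.enorm.measurable]

/-- The multiplier acts as convolution with the dilated kernel, so Young's inequality in $L^1$ gives
a bound independent of `r`. -/
theorem lintegral_fourierInv_dilate_le (μ ψ : 𝓢(E3, ℂ)) {r : ℝ} (hr : r ≠ 0) :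
    ∫⁻ x, ‖𝓕⁻ (fun ξ : E3 => μ (r • ξ) * 𝓕 ψ ξ) x‖ₑ
      ≤ ENNReal.ofReal ((∫ x, ‖𝓕⁻ μ x‖) * ∫ x, ‖ψ x‖) := by
  have e : 𝓕⁻ (fun ξ : E3 => μ (r • ξ) * 𝓕 ψ ξ) =
      SchwartzMap.convolution (ContinuousLinearMap.mul ℂ ℂ) (dilatedKernel μ r hr) ψ := by
    have : (fun ξ : E3 => μ (r • ξ) * 𝓕 ψ ξ) =
        SchwartzMap.pairing (ContinuousLinearMap.mul ℂ ℂ) (𝓕 (dilatedKernel μ r hr)) (𝓕 ψ) := by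
      ext ξ
      rw [SchwartzMap.pairing_apply_apply, fourier_dilatedKernel]
      rfl
    rw [this, ← SchwartzMap.fourierInv_coe]
    rfl
  rw [e]
  refine (lintegral_convolution_le _ _).trans (le_of_eq ?_)
  rw [lintegral_dilatedKernel, ENNReal.ofReal_mul (by positivity),
    ofReal_integral_norm_eq_lintegral_enorm ψ.integrable]

/-! ### A radial cut-off -/

/-- A smooth even cut-off on the line, equal to `1` near `0`. -/
def cutoffProfile (y : ℝ) : ℝ := Real.smoothTransition (2 - y ^ 2)

theorem cutoffProfile_nonneg (y : ℝ) : 0 ≤ cutoffProfile y := Real.smoothTransition.nonneg _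

theorem cutoffProfile_le_one (y : ℝ) : cutoffProfile y ≤ 1 := Real.smoothTransition.le_one _

theorem continuous_cutoffProfile : Continuous cutoffProfile := by
  unfold cutoffProfile
  exact Real.smoothTransition.continuous.comp (by fun_prop)

theorem cutoffProfile_eq_zero {y : ℝ} (hy : 2 ≤ y) : cutoffProfile y = 0 :=
  Real.smoothTransition.zero_of_nonpos (by nlinarith)

theorem cutoffProfile_eq_one {y : ℝ} (h0 : 0 ≤ y) (hy : y ≤ 1) : cutoffProfile y = 1 :=
  Real.smoothTransition.one_of_one_le (by nlinarith)

theorem hasCompactSupport_cutoff :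
    HasCompactSupport (fun ξ : E3 => ((cutoffProfile ‖ξ‖ : ℝ) : ℂ)) := by
  apply HasCompactSupport.of_support_subset_isCompact (isCompact_closedBall (0 : E3) 2)
  intro ξ hξ
  by_contra h
  rw [mem_closedBall_zero_iff, not_le] at h
  exact hξ (by simp [cutoffProfile_eq_zero h.le])

/-- The profile depends on $\|\xi\|^2$ only, so the norm causes no singularity at the origin. -/
theorem contDiff_cutoff : ContDiff ℝ ∞ (fun ξ : E3 => ((cutoffProfile ‖ξ‖ : ℝ) : ℂ)) := by
  have : ContDiff ℝ ∞ (fun ξ : E3 => cutoffProfile ‖ξ‖) :=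
    Real.smoothTransition.contDiff.comp (contDiff_const.sub (contDiff_norm_sq ℝ))
  exact Complex.ofRealCLM.contDiff.comp this

/-- The radial cut-off as a Schwartz function. -/
def cutoff : 𝓢(E3, ℂ) := hasCompactSupport_cutoff.toSchwartzMap contDiff_cutoff

theorem cutoff_apply (ξ : E3) : cutoff ξ = ((cutoffProfile ‖ξ‖ : ℝ) : ℂ) := rfl

theorem integrableOn_cutoffProfile {α : ℝ} (hα : 0 < α) {t : ℝ} (ht : 0 < t) :
    IntegrableOn (fun r : ℝ => r ^ (α - 1) * cutoffProfile (r * t)) (Set.Ioi 0) := by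
  have h1 : IntegrableOn (fun r : ℝ => r ^ (α - 1)) (Set.Ioc 0 (2 / t)) := by
    have := intervalIntegral.intervalIntegrable_rpow' (a := 0) (b := 2 / t) (r := α - 1)
      (by linarith)
    rwa [intervalIntegrable_iff_integrableOn_Ioc_of_le (by positivity)] at this
  have h2 : IntegrableOn (fun r : ℝ => r ^ (α - 1) * cutoffProfile (r * t)) (Set.Ioc 0 (2 / t)) := by
    refine Integrable.mul_bdd (c := 1) h1 ?_ (.of_forall fun r => ?_)
    · exact (continuous_cutoffProfile.comp (by fun_prop)).aestronglyMeasurable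
    · rw [Real.norm_eq_abs, abs_of_nonneg (cutoffProfile_nonneg _)]
      exact cutoffProfile_le_one _
  have h3 : IntegrableOn (fun r : ℝ => r ^ (α - 1) * cutoffProfile (r * t)) (Set.Ioi (2 / t)) := by
    refine IntegrableOn.congr_fun (f := fun _ => (0 : ℝ)) (by simp) (fun r hr => ?_)
      measurableSet_Ioi
    have : 2 ≤ r * t := by
      have : 2 / t < r := hr
      rw [div_lt_iff₀ ht] at this
      exact this.le
    simp [cutoffProfile_eq_zero this]
  rw [← Set.Ioc_union_Ioi_eq_Ioi (a := (0 : ℝ)) (b := 2 / t) (by positivity)]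
  exact h2.union h3

/-- `∫₀^∞ r^{α-1} χ(r) dr`. -/
def cutoffMoment (α : ℝ) : ℝ := ∫ r in Set.Ioi (0 : ℝ), r ^ (α - 1) * cutoffProfile r

theorem cutoffMoment_pos {α : ℝ} (hα : 0 < α) : 0 < cutoffMoment α := by
  have hi := integrableOn_cutoffProfile hα one_pos
  simp only [mul_one] at hi
  have hnn : ∀ r ∈ Set.Ioi (0 : ℝ), 0 ≤ r ^ (α - 1) * cutoffProfile r := fun r hr =>
    mul_nonneg (Real.rpow_nonneg (le_of_lt hr) _) (cutoffProfile_nonneg _)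
  have : ∫ r in Set.Ioc (0 : ℝ) 1, r ^ (α - 1) = 1 / α := by
    rw [← intervalIntegral.integral_of_le zero_le_one, integral_rpow (Or.inl (by linarith))]
    simp [hα.ne']
  calc 0 < 1 / α := by positivity
    _ = ∫ r in Set.Ioc (0 : ℝ) 1, r ^ (α - 1) * cutoffProfile r := by
      rw [← this]
      refine setIntegral_congr_fun measurableSet_Ioc fun r hr => ?_
      simp [cutoffProfile_eq_one hr.1.le hr.2]
    _ ≤ _ := by
      refine setIntegral_mono_set hi ?_ (Set.Ioc_subset_Ioi_self.eventuallyLE)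
      exact (ae_restrict_mem measurableSet_Ioi).mono hnn

/-- The substitution $u=rt$ writes the homogeneous function $t^{-\alpha}$ as a superposition of
dilated cut-offs. -/
theorem integral_cutoffProfile {α t : ℝ} (ht : 0 < t) :
    ∫ r in Set.Ioi (0 : ℝ), r ^ (α - 1) * cutoffProfile (r * t) = t ^ (-α) * cutoffMoment α := by
  have h := integral_comp_mul_right_Ioi (fun u : ℝ => u ^ (α - 1) * cutoffProfile u) 0 ht
  rw [zero_mul] at h
  have e : ∫ r in Set.Ioi (0 : ℝ), (r * t) ^ (α - 1) * cutoffProfile (r * t) =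
      t ^ (α - 1) * ∫ r in Set.Ioi (0 : ℝ), r ^ (α - 1) * cutoffProfile (r * t) := by
    rw [← integral_const_mul]
    refine setIntegral_congr_fun measurableSet_Ioi fun r hr => ?_
    have hr : 0 < r := hr
    rw [Real.mul_rpow hr.le ht.le]; ring
  rw [e, smul_eq_mul] at h
  have hp : t ^ (α - 1) ≠ 0 := (Real.rpow_pos_of_pos ht _).ne'
  have : t ^ (-α) = (t ^ (α - 1))⁻¹ * t⁻¹ := by
    rw [← Real.rpow_neg ht.le, ← Real.rpow_neg_one t, ← Real.rpow_add ht]; congr 1; ring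
  rw [this, mul_assoc, cutoffMoment, ← h, inv_mul_cancel_left₀ hp]

/-! ### Integrability of the Riesz potential of a derivative -/

theorem fourierInv_sub_of_integrable {f g : E3 → ℂ} (hf : Integrable f) (hg : Integrable g) :
    𝓕⁻ (fun ξ => f ξ - g ξ) = fun x => 𝓕⁻ f x - 𝓕⁻ g x := by
  ext x
  simp only [Real.fourierInv_eq, smul_sub]
  refine integral_sub ?_ ?_
  · exact (Real.fourierIntegral_convergent_iff (V := E3) (-x)).2 hf |>.congr
      (.of_forall fun v => by simp)
  · exact (Real.fourierIntegral_convergent_iff (V := E3) (-x)).2 hg |>.congr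
      (.of_forall fun v => by simp)

/-- For small `r` the derivative stays on `ψ`. For large `r` it is moved onto the cut-off,
$\xi_j\chi(r\xi)=r^{-1}(r\xi_j)\chi(r\xi)$, which gains $r^{-1}$. -/
theorem lintegral_fourierInv_cutoff_dS_le (j : Fin 3) (ψ : 𝓢(E3, ℂ)) :
    ∃ B : ℝ, 0 ≤ B ∧ ∀ r : ℝ, 0 < r →
      ∫⁻ x, ‖𝓕⁻ (fun ξ : E3 => cutoff (r • ξ) * 𝓕 (dS j ψ) ξ) x‖ₑ
        ≤ ENNReal.ofReal (min B (B * r⁻¹)) := by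
  set A := (∫ x, ‖𝓕⁻ cutoff x‖) * ∫ x, ‖dS j ψ x‖ with hA
  -- This Schwartz function is the gradient symbol times the cut-off.
  set D := 𝓕 (dS j (𝓕⁻ cutoff)) with hD
  set B := (∫ x, ‖𝓕⁻ D x‖) * ∫ x, ‖ψ x‖ with hB
  have hA0 : 0 ≤ A := by positivity
  have hB0 : 0 ≤ B := by positivity
  refine ⟨max A B, hA0.trans (le_max_left _ _), fun r hr => ?_⟩
  have h1 := lintegral_fourierInv_dilate_le cutoff (dS j ψ) hr.ne'
  have h2 := lintegral_fourierInv_dilate_le D ψ hr.ne'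
  have e : (fun ξ : E3 => cutoff (r • ξ) * 𝓕 (dS j ψ) ξ) =
      fun ξ : E3 => ((r⁻¹ : ℝ) : ℂ) • (D (r • ξ) * 𝓕 ψ ξ) := by
    ext ξ
    have : (r : ℂ) ≠ 0 := by exact_mod_cast hr.ne'
    rw [hD, fourier_dS, fourier_dS, fourier_fourierInv_eq, smul_eq_mul]
    simp only [gradSymbol, PiLp.smul_apply, smul_eq_mul, Complex.ofReal_mul, Complex.ofReal_inv]
    field_simp
  rcases le_total (max A B) (max A B * r⁻¹) with h | h
  · rw [min_eq_left h]
    exact h1.trans (ENNReal.ofReal_le_ofReal (le_max_left _ _))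
  · rw [min_eq_right h, e]
    have e2 : ∀ x, 𝓕⁻ (fun ξ : E3 => ((r⁻¹ : ℝ) : ℂ) • (D (r • ξ) * 𝓕 ψ ξ)) x =
        ((r⁻¹ : ℝ) : ℂ) * 𝓕⁻ (fun ξ : E3 => D (r • ξ) * 𝓕 ψ ξ) x := by
      intro x
      simp only [Real.fourierInv_eq, smul_comm _ (((r⁻¹ : ℝ) : ℂ))]
      rw [integral_smul, smul_eq_mul]
    simp_rw [e2, enorm_mul]
    rw [lintegral_const_mul' _ _ (by simp)]
    calc _ ≤ ‖((r⁻¹ : ℝ) : ℂ)‖ₑ * ENNReal.ofReal B := by gcongr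
      _ = ENNReal.ofReal (r⁻¹ * B) := by
        rw [ENNReal.ofReal_mul (p := r⁻¹) (by positivity)]
        congr 1
        rw [← ofReal_norm, Complex.norm_real, Real.norm_of_nonneg (by positivity)]
      _ ≤ _ := by
        apply ENNReal.ofReal_le_ofReal
        rw [mul_comm]
        gcongr
        exact le_max_right _ _

/-- Near zero $\alpha>0$ suffices; at infinity the integrand is of order $r^{\alpha-2}$, so
$\alpha<1$ is needed. -/
theorem integrableOn_rpow_mul_min {α : ℝ} (h0 : 0 < α) (h1 : α < 1) (B : ℝ) (hB : 0 ≤ B) :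
    IntegrableOn (fun r : ℝ => r ^ (α - 1) * min B (B * r⁻¹)) (Set.Ioi 0) := by
  have m : AEStronglyMeasurable (fun r : ℝ => r ^ (α - 1) * min B (B * r⁻¹)) := by
    have : Measurable (fun r : ℝ => r ^ (α - 1) * min B (B * r⁻¹)) := by fun_prop
    exact this.aestronglyMeasurable
  have i1 : IntegrableOn (fun r : ℝ => r ^ (α - 1) * B) (Set.Ioc 0 1) := by
    have := intervalIntegral.intervalIntegrable_rpow' (a := 0) (b := 1) (r := α - 1) (by linarith)
    rw [intervalIntegrable_iff_integrableOn_Ioc_of_le zero_le_one] at this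
    exact this.mul_const B
  have i2 : IntegrableOn (fun r : ℝ => r ^ (α - 2) * B) (Set.Ioi 1) :=
    (integrableOn_Ioi_rpow_of_lt (by linarith) one_pos).mul_const B
  rw [← Set.Ioc_union_Ioi_eq_Ioi (a := (0 : ℝ)) (b := 1) zero_le_one]
  refine IntegrableOn.union ?_ ?_
  · refine Integrable.mono' i1 m.restrict ((ae_restrict_mem measurableSet_Ioc).mono fun r hr => ?_)
    have hr0 : 0 < r := hr.1
    rw [Real.norm_of_nonneg (by positivity)]
    gcongr
    exact min_le_left _ _
  · refine Integrable.mono' i2 m.restrict ((ae_restrict_mem measurableSet_Ioi).mono fun r hr => ?_)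
    have hr0 : 0 < r := one_pos.trans hr
    rw [Real.norm_of_nonneg (by positivity)]
    calc _ ≤ r ^ (α - 1) * (B * r⁻¹) := by gcongr; exact min_le_right _ _
      _ = (r ^ (α - 1) * r⁻¹) * B := by ring
      _ = _ := by
        rw [← Real.rpow_neg_one r, ← Real.rpow_add hr0]; ring_nf

/-- Integrating the modulus in `r` first gives `cutoffMoment α` times $|\xi|^{-\alpha}|\ell(\xi)|$,
integrable by assumption. This is what permits Fubini below. -/
theorem integrable_prod_cutoff {α : ℝ} (h0 : 0 < α) {ℓ : 𝓢(E3, ℂ)}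
    (hℓ : Integrable fun ξ : E3 => ((‖ξ‖ ^ (-α) : ℝ) : ℂ) * ℓ ξ) :
    Integrable (fun p : E3 × ℝ => ((p.2 ^ (α - 1) : ℝ) : ℂ) * (cutoff (p.2 • p.1) * ℓ p.1))
      (volume.prod (volume.restrict (Set.Ioi 0))) := by
  have hc := cutoff.continuous
  have hl := ℓ.continuous
  have meas : Measurable
      (fun p : E3 × ℝ => ((p.2 ^ (α - 1) : ℝ) : ℂ) * (cutoff (p.2 • p.1) * ℓ p.1)) := by
    have a1 : Continuous (fun p : E3 × ℝ => cutoff (p.2 • p.1) * ℓ p.1) := by fun_prop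
    have a2 : Measurable (fun p : E3 × ℝ => ((p.2 ^ (α - 1) : ℝ) : ℂ)) := by fun_prop
    exact a2.mul a1.measurable
  have ne : ∀ᵐ ξ : E3, ξ ≠ 0 := by simp [ae_iff, measure_singleton]
  have key : ∀ ξ : E3, ∀ r ∈ Set.Ioi (0 : ℝ),
      ‖((r ^ (α - 1) : ℝ) : ℂ) * (cutoff (r • ξ) * ℓ ξ)‖ =
        r ^ (α - 1) * cutoffProfile (r * ‖ξ‖) * ‖ℓ ξ‖ := by
    intro ξ r hr
    have hr : 0 < r := hr
    rw [norm_mul, norm_mul, cutoff_apply, Complex.norm_real, Complex.norm_real,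
      Real.norm_of_nonneg (by positivity), Real.norm_of_nonneg (cutoffProfile_nonneg _), norm_smul,
      Real.norm_of_nonneg hr.le, mul_assoc]
  rw [integrable_prod_iff meas.aestronglyMeasurable]
  constructor
  · filter_upwards [ne] with ξ hξ
    have hx : 0 < ‖ξ‖ := norm_pos_iff.2 hξ
    have := (integrableOn_cutoffProfile h0 hx).mul_const ‖ℓ ξ‖
    refine Integrable.mono' this ?_ ((ae_restrict_mem measurableSet_Ioi).mono fun r hr => ?_)
    · exact (meas.comp measurable_prodMk_left).aestronglyMeasurable
    · exact (key ξ r hr).le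
  · refine (hℓ.norm.const_mul (cutoffMoment α)).congr ?_
    filter_upwards [ne] with ξ hξ
    have hx : 0 < ‖ξ‖ := norm_pos_iff.2 hξ
    rw [setIntegral_congr_fun measurableSet_Ioi (key ξ), integral_mul_const,
      integral_cutoffProfile hx, norm_mul, Complex.norm_real, Real.norm_of_nonneg (by positivity)]
    ring

theorem fourierInv_norm_rpow_mul_eq {α : ℝ} (h0 : 0 < α) {ℓ : 𝓢(E3, ℂ)}
    (hℓ : Integrable fun ξ : E3 => ((‖ξ‖ ^ (-α) : ℝ) : ℂ) * ℓ ξ) (x : E3) :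
    (cutoffMoment α : ℂ) * 𝓕⁻ (fun ξ : E3 => ((‖ξ‖ ^ (-α) : ℝ) : ℂ) * ℓ ξ) x =
      ∫ r in Set.Ioi (0 : ℝ), ((r ^ (α - 1) : ℝ) : ℂ) *
        𝓕⁻ (fun ξ : E3 => cutoff (r • ξ) * ℓ ξ) x := by
  have hprod := integrable_prod_cutoff h0 hℓ
  have ne : ∀ᵐ ξ : E3, ξ ≠ 0 := by simp [ae_iff, measure_singleton]
  have hF : Integrable (Function.uncurry fun (ξ : E3) (r : ℝ) =>
      ((r ^ (α - 1) : ℝ) : ℂ) * (Real.fourierChar (inner ℝ ξ x) • (cutoff (r • ξ) * ℓ ξ)))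
      (volume.prod (volume.restrict (Set.Ioi 0))) := by
    have c : Continuous fun p : E3 × ℝ => ((Real.fourierChar (inner ℝ p.1 x) : Circle) : ℂ) := by
      have := Real.continuous_fourierChar
      fun_prop
    refine (hprod.bdd_mul (c := 1) c.aestronglyMeasurable (.of_forall fun p =>
      (Circle.norm_coe _).le)).congr
      (.of_forall fun p => ?_)
    simp only [Function.uncurry, Circle.smul_def, smul_eq_mul]
    ring
  calc _ = ∫ ξ : E3, ∫ r in Set.Ioi (0 : ℝ), ((r ^ (α - 1) : ℝ) : ℂ) *
        (Real.fourierChar (inner ℝ ξ x) • (cutoff (r • ξ) * ℓ ξ)) := by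
        rw [Real.fourierInv_eq, ← integral_const_mul]
        refine integral_congr_ae ?_
        filter_upwards [ne] with ξ hξ
        have hx : 0 < ‖ξ‖ := norm_pos_iff.2 hξ
        have e : ∀ r ∈ Set.Ioi (0 : ℝ), ((r ^ (α - 1) : ℝ) : ℂ) *
            (Real.fourierChar (inner ℝ ξ x) • (cutoff (r • ξ) * ℓ ξ)) =
            ((r ^ (α - 1) * cutoffProfile (r * ‖ξ‖) : ℝ) : ℂ) *
              (Real.fourierChar (inner ℝ ξ x) • ℓ ξ) := by
          intro r hr
          have hr : 0 < r := hr
          rw [cutoff_apply, norm_smul, Real.norm_of_nonneg hr.le]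
          simp only [Circle.smul_def, smul_eq_mul]
          push_cast
          ring
        rw [setIntegral_congr_fun measurableSet_Ioi e, integral_mul_const, integral_complex_ofReal,
          integral_cutoffProfile hx]
        simp only [Circle.smul_def, smul_eq_mul]
        push_cast
        ring
    _ = ∫ r in Set.Ioi (0 : ℝ), ∫ ξ : E3, ((r ^ (α - 1) : ℝ) : ℂ) *
        (Real.fourierChar (inner ℝ ξ x) • (cutoff (r • ξ) * ℓ ξ)) := integral_integral_swap hF
    _ = _ := by
        refine integral_congr_ae (.of_forall fun r => ?_)
        simp only
        rw [integral_const_mul, Real.fourierInv_eq]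

/-- Minkowski's integral inequality: the $L^1$ norm of the superposition is at most the
superposition of the $L^1$ norms. -/
theorem lintegral_lt_top_of_superposition {α : ℝ} (h0 : 0 < α) (h1 : α < 1) {M B : ℝ} (hM : 0 < M)
    (hB0 : 0 ≤ B) {f : E3 → ℂ} {g : ℝ → E3 → ℂ} (gmeas : Measurable (Function.uncurry g))
    (hf : ∀ x, (M : ℂ) * f x = ∫ r in Set.Ioi (0 : ℝ), ((r ^ (α - 1) : ℝ) : ℂ) * g r x)
    (hB : ∀ r : ℝ, 0 < r → ∫⁻ x, ‖g r x‖ₑ ≤ ENNReal.ofReal (min B (B * r⁻¹))) :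
    ∫⁻ x, ‖f x‖ₑ < ⊤ := by
  have bound : ∀ x, ENNReal.ofReal M * ‖f x‖ₑ ≤
      ∫⁻ r in Set.Ioi (0 : ℝ), ENNReal.ofReal (r ^ (α - 1)) * ‖g r x‖ₑ := by
    intro x
    have e : ENNReal.ofReal M * ‖f x‖ₑ = ‖(M : ℂ) * f x‖ₑ := by
      rw [enorm_mul, ← ofReal_norm (M : ℂ), Complex.norm_real, Real.norm_of_nonneg hM.le]
    rw [e, hf]
    refine (enorm_integral_le_lintegral_enorm _).trans
      (setLIntegral_mono' measurableSet_Ioi fun r hr => ?_)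
    have hr : 0 < r := hr
    rw [enorm_mul, ← ofReal_norm ((r ^ (α - 1) : ℝ) : ℂ), Complex.norm_real,
      Real.norm_of_nonneg (by positivity)]
  have total : ENNReal.ofReal M * ∫⁻ x, ‖f x‖ₑ < ⊤ := by
    calc _ = ∫⁻ x, ENNReal.ofReal M * ‖f x‖ₑ :=
          (lintegral_const_mul' _ _ ENNReal.ofReal_ne_top).symm
      _ ≤ ∫⁻ x, ∫⁻ r in Set.Ioi (0 : ℝ), ENNReal.ofReal (r ^ (α - 1)) * ‖g r x‖ₑ :=
          lintegral_mono bound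
      _ = ∫⁻ r in Set.Ioi (0 : ℝ), ∫⁻ x, ENNReal.ofReal (r ^ (α - 1)) * ‖g r x‖ₑ := by
          refine lintegral_lintegral_swap ?_
          have a1 : Measurable fun p : E3 × ℝ => g p.2 p.1 := gmeas.comp measurable_swap
          have a2 : Measurable fun p : E3 × ℝ => ENNReal.ofReal (p.2 ^ (α - 1)) := by fun_prop
          exact (a2.mul a1.enorm).aemeasurable
      _ ≤ ∫⁻ r in Set.Ioi (0 : ℝ), ENNReal.ofReal (r ^ (α - 1) * min B (B * r⁻¹)) := by
          refine setLIntegral_mono' measurableSet_Ioi fun r hr => ?_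
          have hr : 0 < r := hr
          rw [lintegral_const_mul' _ _ ENNReal.ofReal_ne_top, ENNReal.ofReal_mul (by positivity)]
          gcongr
          exact hB r hr
      _ < ⊤ := (integrableOn_rpow_mul_min h0 h1 B hB0).lintegral_lt_top
  by_contra h
  rw [not_lt, top_le_iff] at h
  rw [h, ENNReal.mul_top (by simpa using hM)] at total
  exact lt_irrefl _ total

theorem measurable_fourierInv_dilate (ℓ : 𝓢(E3, ℂ)) :
    Measurable (Function.uncurry fun (r : ℝ) (x : E3) =>
      𝓕⁻ (fun ξ : E3 => cutoff (r • ξ) * ℓ ξ) x) := by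
  have c : Continuous fun q : (ℝ × E3) × E3 =>
      Real.fourierChar (inner ℝ q.2 q.1.2) • (cutoff (q.1.1 • q.2) * ℓ q.2) := by
    have hc := cutoff.continuous
    have hl := ℓ.continuous
    have := Real.continuous_fourierChar
    simp only [Circle.smul_def]
    fun_prop
  have := (c.stronglyMeasurable.integral_prod_right' (ν := (volume : Measure E3))).measurable
  convert this using 2 with p
  simp only [Function.uncurry, Real.fourierInv_eq]

/-- The pole makes the transform nonsmooth at the origin, so integrability does not follow from
Schwartz decay. It comes from the superposition of cut-offs together with the gain $r^{-1}$ due to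
the derivative. -/
theorem integrable_fourierInv_rpow_mul_fourier_dS {α : ℝ} (h0 : 0 < α) (h1 : α < 1) (j : Fin 3)
    (ψ : 𝓢(E3, ℂ)) (hℓ : Integrable fun ξ : E3 => ((‖ξ‖ ^ (-α) : ℝ) : ℂ) * 𝓕 (dS j ψ) ξ) :
    Integrable (𝓕⁻ fun ξ : E3 => ((‖ξ‖ ^ (-α) : ℝ) : ℂ) * 𝓕 (dS j ψ) ξ) := by
  obtain ⟨B, hB0, hB⟩ := lintegral_fourierInv_cutoff_dS_le j ψ
  exact ⟨(continuous_fourierInv_of_integrable hℓ).aestronglyMeasurable,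
    lintegral_lt_top_of_superposition h0 h1 (cutoffMoment_pos h0) hB0
      (measurable_fourierInv_dilate _) (fourierInv_norm_rpow_mul_eq h0 hℓ) hB⟩

/-! ### The projected incident field -/

theorem fracSymbol_neg_half (α : ℝ) (ξ : E3) :
    fracSymbol (-(α / 2)) ξ = (((2 * Real.pi) ^ (-α) : ℝ) : ℂ) * ((‖ξ‖ ^ (-α) : ℝ) : ℂ) := by
  have := Real.pi_pos
  rw [fracSymbol, Real.mul_rpow (by positivity) (norm_nonneg _), ← Complex.ofReal_mul]
  ring_nf

theorem integrable_rieszPotential_dS {α : ℝ} (h0 : 0 < α) (h1 : α < 1) (j : Fin 3)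
    (ψ : 𝓢(E3, ℂ)) : Integrable (fracLaplacian (-(α / 2)) (dS j ψ)) := by
  have hv : VanishingDecay (fun ξ => 𝓕 (dS j ψ) ξ) := by
    simp only [fourier_dS]
    exact vanishingDecay_gradSymbol_mul _ j
  have hi := (hv.fracSymbol_mul (a := -(α / 2)) (by linarith) (by linarith)).integrable
  have hp : (0 : ℝ) < (2 * Real.pi) ^ (-α) := Real.rpow_pos_of_pos (by positivity) _
  have hc : (((2 * Real.pi) ^ (-α) : ℝ) : ℂ) ≠ 0 := by exact_mod_cast hp.ne'
  have e : (fun ξ => fracSymbol (-(α / 2)) ξ * 𝓕 (dS j ψ) ξ) = fun ξ =>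
      (((2 * Real.pi) ^ (-α) : ℝ) : ℂ) • (((‖ξ‖ ^ (-α) : ℝ) : ℂ) * 𝓕 (dS j ψ) ξ) := by
    ext ξ; rw [fracSymbol_neg_half, smul_eq_mul, mul_assoc]
  have hℓ : Integrable fun ξ : E3 => ((‖ξ‖ ^ (-α) : ℝ) : ℂ) * 𝓕 (dS j ψ) ξ := by
    rw [e] at hi
    exact (integrable_fun_smul_iff hc _).1 hi
  have key := (integrable_fourierInv_rpow_mul_fourier_dS h0 h1 j ψ hℓ).smul
    (((2 * Real.pi) ^ (-α) : ℝ) : ℂ)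
  rw [fracLaplacian_eq, e]
  convert key using 1
  ext x
  simp only [Real.fourierInv_eq, Pi.smul_apply, smul_comm _ ((((2 * Real.pi) ^ (-α) : ℝ) : ℂ))]
  rw [integral_smul]

theorem integrable_rieszPotential_sub {a : ℝ} {f g : 𝓢(E3, ℂ)}
    (hf : Integrable fun ξ => fracSymbol a ξ * 𝓕 f ξ)
    (hg : Integrable fun ξ => fracSymbol a ξ * 𝓕 g ξ)
    (hf' : Integrable (fracLaplacian a f)) (hg' : Integrable (fracLaplacian a g)) :
    Integrable (fracLaplacian a (f - g : 𝓢(E3, ℂ))) := by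
  have : (fun ξ => fracSymbol a ξ * 𝓕 (f - g) ξ) =
      fun ξ => fracSymbol a ξ * 𝓕 f ξ - fracSymbol a ξ * 𝓕 g ξ := by
    ext ξ; rw [fourier_sub_apply, mul_sub]
  rw [fracLaplacian_eq, this, fourierInv_sub_of_integrable hf hg]
  exact hf'.sub hg'

theorem integrable_rieszPotential_curlS {α : ℝ} (h0 : 0 < α) (h1 : α < 1)
    (φ : Fin 3 → 𝓢(E3, ℂ)) (i : Fin 3) : Integrable (rieszPotential α (curlS φ i)) := by
  have hv : ∀ j ψ, Integrable (fun ξ => fracSymbol (-(α / 2)) ξ * 𝓕 (dS j ψ) ξ) := by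
    intro j ψ
    have hv : VanishingDecay (fun ξ => 𝓕 (dS j ψ) ξ) := by
      simp only [fourier_dS]
      exact vanishingDecay_gradSymbol_mul _ j
    exact (hv.fracSymbol_mul (a := -(α / 2)) (by linarith) (by linarith)).integrable
  have key : ∀ j j' ψ ψ', Integrable (fracLaplacian (-(α / 2)) (dS j ψ - dS j' ψ' : 𝓢(E3, ℂ))) :=
    fun j j' ψ ψ' => integrable_rieszPotential_sub (hv _ _) (hv _ _)
      (integrable_rieszPotential_dS h0 h1 _ _) (integrable_rieszPotential_dS h0 h1 _ _)
  fin_cases i <;> exact key _ _ _ _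

/-- The plane wave `e^{iκ x·d}`. -/
def scalarWave (κ : ℝ) (d : E3) (x : E3) : ℂ :=
  Complex.exp (Complex.I * ((κ * inner ℝ x d : ℝ) : ℂ))

theorem continuous_scalarWave (κ : ℝ) (d : E3) : Continuous (scalarWave κ d) := by
  unfold scalarWave; fun_prop

theorem norm_scalarWave (κ : ℝ) (d x : E3) : ‖scalarWave κ d x‖ = 1 := by
  rw [scalarWave, mul_comm, Complex.norm_exp_ofReal_mul_I]

theorem pderiv3_scalarWave (κ : ℝ) (d : E3) (c : ℂ) (j : Fin 3) (x : E3) :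
    pderiv3 j (fun y => c * scalarWave κ d y) x =
      Complex.I * κ * (d j : ℂ) * c * scalarWave κ d x := by
  have h1 : HasFDerivAt (fun y : E3 => (κ * inner ℝ y d : ℝ)) (κ • (innerSL ℝ d)) x := by
    have : HasFDerivAt (fun y : E3 => inner ℝ d y) (innerSL ℝ d) x := (innerSL ℝ d).hasFDerivAt
    simpa [real_inner_comm] using this.const_mul κ
  have h2 : HasFDerivAt (fun y : E3 => ((κ * inner ℝ y d : ℝ) : ℂ))
      (Complex.ofRealCLM.comp (κ • (innerSL ℝ d))) x := Complex.ofRealCLM.hasFDerivAt.comp x h1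
  have h3 := ((h2.const_mul Complex.I).cexp).const_mul c
  rw [pderiv3]
  have : (fun y => c * scalarWave κ d y) =
      fun y => c * Complex.exp (Complex.I * ((κ * inner ℝ y d : ℝ) : ℂ)) := rfl
  rw [this, h3.fderiv]
  simp [scalarWave, EuclideanSpace.inner_single_right]
  ring

theorem integral_scalarWave_mul (κ : ℝ) (d : E3) (f : E3 → ℂ) :
    ∫ x, scalarWave κ d x * f x = 𝓕 f (-(κ / (2 * Real.pi)) • d) := by
  rw [Real.fourier_eq]
  congr 1 with x
  rw [Circle.smul_def, smul_eq_mul, Real.fourierChar_apply, scalarWave]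
  congr 2
  rw [inner_smul_right]
  have : (Real.pi : ℂ) ≠ 0 := by exact_mod_cast Real.pi_ne_zero
  push_cast
  field_simp

/-- Pairing with the wave evaluates a Fourier transform at one frequency. Inversion holds there
pointwise, since the potential is in $L^1$ and its symbol is continuous away from the origin. -/
theorem integral_scalarWave_mul_rieszPotential_curlS {α : ℝ} (h0 : 0 < α) (h1 : α < 1) {κ : ℝ}
    (hκ : 0 < κ) {d : E3} (hd : d ≠ 0) (φ : Fin 3 → 𝓢(E3, ℂ)) (i : Fin 3) :
    ∫ x, scalarWave κ d x * rieszPotential α (curlS φ i) x =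
      fracSymbol (-(α / 2)) (-(κ / (2 * Real.pi)) • d) *
        𝓕 (curlS φ i) (-(κ / (2 * Real.pi)) • d) := by
  set ξ₀ : E3 := -(κ / (2 * Real.pi)) • d with hξ
  have hp := Real.pi_pos
  have hξ0 : ξ₀ ≠ 0 := by
    rw [hξ, smul_ne_zero_iff]
    exact ⟨neg_ne_zero.2 (by positivity), hd⟩
  have hF : Integrable fun ξ => fracSymbol (-(α / 2)) ξ * 𝓕 (curlS φ i) ξ :=
    ((vanishingDecay_fourier_curlS φ i).fracSymbol_mul (by linarith) (by linarith)).integrable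
  have hI : Integrable (𝓕⁻ fun ξ => fracSymbol (-(α / 2)) ξ * 𝓕 (curlS φ i) ξ) :=
    integrable_rieszPotential_curlS h0 h1 φ i
  have hI' : Integrable (𝓕 fun ξ => fracSymbol (-(α / 2)) ξ * 𝓕 (curlS φ i) ξ) := by
    have := hI.comp_neg
    convert this using 1
    ext x
    rw [Real.fourierInv_eq_fourier_neg, neg_neg]
  rw [integral_scalarWave_mul]
  have hc : ContinuousAt (fun ξ => fracSymbol (-(α / 2)) ξ * 𝓕 (curlS φ i) ξ) ξ₀ := by
    refine ContinuousAt.mul ?_ (𝓕 (curlS φ i)).continuous.continuousAt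
    have : ContinuousAt (fun ξ : E3 => (2 * Real.pi * ‖ξ‖) ^ (2 * (-(α / 2)))) ξ₀ := by
      refine ContinuousAt.rpow_const (by fun_prop) (Or.inl ?_)
      have := norm_pos_iff.2 hξ0
      positivity
    exact Complex.continuous_ofReal.continuousAt.comp this
  exact hF.fourier_fourierInv_eq hI' hc

/-- The incident field is given by a bounded continuous function. -/
theorem exists_incidentField_eq {s k : ℝ} (hs0 : 0 < s) (hs1 : s < 1) (hk : 0 < k) (p d : E3) :
    ∃ e : Fin 3 → E3 → ℂ, (∀ j, Continuous (e j)) ∧ (∃ M : ℝ, ∀ j x, ‖e j x‖ ≤ M) ∧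
      ∀ φ : Fin 3 → 𝓢(E3, ℂ), incidentField s k p d (testField φ) = ∑ j, ∫ x, e j x * φ j x := by
  set κ : ℝ := k ^ (1 / s) with hκdef
  have hκ : 0 < κ := Real.rpow_pos_of_pos hk _
  have hcurl : ∃ C : Fin 3 → ℂ, (d = 0 → C = 0) ∧
      curlField (planeWave s k p d) = fun x i => C i * scalarWave κ d x := by
    -- The amplitude is $i\kappa\,d\times p$.
    refine ⟨![Complex.I * κ * (d 1) * (p 2) - Complex.I * κ * (d 2) * (p 1),
      Complex.I * κ * (d 2) * (p 0) - Complex.I * κ * (d 0) * (p 2),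
      Complex.I * κ * (d 0) * (p 1) - Complex.I * κ * (d 1) * (p 0)], ?_, ?_⟩
    · rintro rfl
      ext i
      fin_cases i <;> simp
    · have hpw : ∀ i, (fun y => planeWave s k p d y i) = fun y => (p i : ℂ) * scalarWave κ d y :=
        fun i => rfl
      ext x i
      simp only [curlField, hpw, pderiv3_scalarWave]
      fin_cases i <;> simp <;> ring
  obtain ⟨C, hC0, hC⟩ := hcurl
  have start : ∀ φ : Fin 3 → 𝓢(E3, ℂ), incidentField s k p d (testField φ) =
      ∑ i, C i * ∫ x, scalarWave κ d x * rieszPotential (1 - s) (curlS φ i) x := by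
    intro φ
    rw [incidentField, piCurlStar, fieldPairing, hC, curlField_testField]
    simp only [rieszPotentialVec, testField]
    rw [integral_finsetSum]
    · simp_rw [mul_assoc, integral_const_mul]
    · intro i _
      refine (integrable_rieszPotential_curlS (by linarith) (by linarith) φ i).bdd_mul
        (c := ‖C i‖) ?_ (.of_forall fun x => ?_)
      · exact (continuous_const.mul (continuous_scalarWave κ d)).aestronglyMeasurable
      · rw [norm_mul, norm_scalarWave, mul_one]
  -- For `d = 0` the wave has frequency zero, where the symbol is singular; but then its curl
  -- vanishes, and so does the field.
  rcases eq_or_ne d 0 with hd | hd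
  · refine ⟨fun _ _ => 0, fun _ => continuous_const, ⟨0, by simp⟩, fun φ => ?_⟩
    rw [start, hC0 hd]
    simp
  set ξ₀ : E3 := -(κ / (2 * Real.pi)) • d with hξ
  set σ := fracSymbol (-((1 - s) / 2)) ξ₀ with hσ
  set g : Fin 3 → ℂ := fun j => gradSymbol j ξ₀ with hg
  -- The curl is transposed by the triple product $C\cdot(g\times F)=(C\times g)\cdot F$.
  set c : Fin 3 → ℂ := ![σ * (C 1 * g 2 - C 2 * g 1), σ * (C 2 * g 0 - C 0 * g 2),
    σ * (C 0 * g 1 - C 1 * g 0)] with hc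
  refine ⟨fun j x => c j * scalarWave κ d x,
    fun j => continuous_const.mul (continuous_scalarWave κ d), ⟨∑ j, ‖c j‖, fun j x => ?_⟩,
    fun φ => ?_⟩
  · rw [norm_mul, norm_scalarWave, mul_one]
    exact Finset.single_le_sum (f := fun j => ‖c j‖) (fun _ _ => norm_nonneg _) (Finset.mem_univ j)
  · rw [start]
    have e1 : ∀ i, ∫ x, scalarWave κ d x * rieszPotential (1 - s) (curlS φ i) x =
        σ * 𝓕 (curlS φ i) ξ₀ := fun i =>
      integral_scalarWave_mul_rieszPotential_curlS (by linarith) (by linarith) hκ hd φ i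
    have e2 : ∀ j, ∫ x, c j * scalarWave κ d x * φ j x = c j * 𝓕 (φ j) ξ₀ := by
      intro j
      simp_rw [mul_assoc]
      rw [integral_const_mul, integral_scalarWave_mul]
      rfl
    simp only [e1, e2, Fin.sum_univ_three, fourier_curlS]
    simp [hc, hg]
    ring

theorem incidentField_gradS (s k : ℝ) (p d : E3) (ψ : 𝓢(E3, ℂ)) :
    incidentField s k p d (testField (gradS ψ)) = 0 := by
  rw [incidentField, piCurlStar, fieldPairing, curlField_testField, curlS_gradS]
  have : ∀ (x : E3) (i : Fin 3), rieszPotentialVec (1 - s) (testField 0) x i = 0 := by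
    intro x i
    have h : rieszPotentialVec (1 - s) (testField 0) x i =
      fracLaplacian (-((1 - s) / 2)) (0 : 𝓢(E3, ℂ)) x := rfl
    rw [h, fracLaplacian_eq, FourierTransform.fourier_zero]
    simp [Real.fourierInv_eq]
  simp [this]

/-! ### Weighted `L²` spaces and convolution -/

/-- `(1 + |ξ|)^σ V ∈ L²`. -/
def WeightedL2 (σ : ℝ) (V : E3 → ℂ) : Prop :=
  MemLp (fun ξ => (((1 + ‖ξ‖) ^ σ : ℝ) : ℂ) * V ξ) 2

/-- Peetre's inequality: moving a polynomial weight through a convolution costs only a polynomial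
factor in the kernel variable. -/
theorem one_add_norm_rpow_peetre (σ : ℝ) (ξ ζ : E3) :
    (1 + ‖ζ‖) ^ σ ≤ (1 + ‖ξ‖) ^ σ * (1 + ‖ξ - ζ‖) ^ |σ| := by
  have base : ∀ a b : E3, 1 + ‖a‖ ≤ (1 + ‖b‖) * (1 + ‖b - a‖) := by
    intro a b
    have h : ‖a‖ ≤ ‖b‖ + ‖b - a‖ := by
      have := norm_sub_le b (b - a); rwa [sub_sub_cancel] at this
    nlinarith [mul_nonneg (norm_nonneg b) (norm_nonneg (b - a))]
  rcases le_total 0 σ with h | h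
  · rw [abs_of_nonneg h, ← Real.mul_rpow (by positivity) (by positivity)]
    exact Real.rpow_le_rpow (by positivity) (base ζ ξ) h
  · rw [abs_of_nonpos h]
    have h1 := Real.rpow_le_rpow_of_nonpos (z := σ) (by positivity) (base ξ ζ) h
    rw [Real.mul_rpow (by positivity) (by positivity), norm_sub_rev] at h1
    rw [Real.rpow_neg (by positivity), ← div_eq_mul_inv, le_div_iff₀ (by positivity)]
    exact h1

theorem WeightedL2.mono {σ τ : ℝ} (h : τ ≤ σ) {V : E3 → ℂ} (hm : Measurable V)
    (hV : WeightedL2 σ V) : WeightedL2 τ V := by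
  refine MemLp.mono hV (by fun_prop) (.of_forall fun ξ => ?_)
  rw [norm_mul, norm_mul, Complex.norm_real, Complex.norm_real,
    Real.norm_of_nonneg (by positivity), Real.norm_of_nonneg (by positivity)]
  gcongr
  linarith [norm_nonneg ξ]

/-- The Cauchy–Schwarz inequality for the measure $k\,d\xi$. -/
theorem lintegral_mul_sq_le {k A : E3 → ENNReal} (hk : Measurable k) (hA : Measurable A) :
    (∫⁻ ξ, A ξ * k ξ) ^ 2 ≤ (∫⁻ ξ, A ξ ^ 2 * k ξ) * ∫⁻ ξ, k ξ := by
  have h := ENNReal.lintegral_mul_le_Lp_mul_Lq (volume : Measure E3) Real.HolderConjugate.two_two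
    (f := fun ξ => A ξ * k ξ ^ (1 / 2 : ℝ)) (g := fun ξ => k ξ ^ (1 / 2 : ℝ))
    (by fun_prop) (by fun_prop)
  have e0 : ∀ x : ENNReal, x ^ (1 / 2 : ℝ) * x ^ (1 / 2 : ℝ) = x := by
    intro x
    rw [← ENNReal.rpow_add_of_nonneg _ _ (by norm_num) (by norm_num)]; norm_num
  have e1 : ∀ x : ENNReal, (x ^ (1 / 2 : ℝ)) ^ (2 : ℝ) = x := by
    intro x; rw [← ENNReal.rpow_mul]; norm_num
  have e2 : ∀ x : ENNReal, (x ^ (1 / 2 : ℝ)) ^ 2 = x := by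
    intro x; rw [sq, e0]
  simp only [Pi.mul_apply, mul_assoc, e0] at h
  simp only [ENNReal.mul_rpow_of_nonneg _ _ zero_le_two, e1] at h
  calc _ ≤ _ := pow_le_pow_left' h 2
    _ = _ := by rw [mul_pow, e2, e2]; simp

theorem lintegral_conv_sq_le {k A : E3 → ENNReal} (hk : Measurable k) (hA : Measurable A) :
    ∫⁻ ζ, (∫⁻ ξ, A ξ * k (ξ - ζ)) ^ 2 ≤ (∫⁻ y, k y) ^ 2 * ∫⁻ ξ, A ξ ^ 2 := by
  have m : Measurable (Function.uncurry fun (ζ ξ : E3) => A ξ ^ 2 * k (ξ - ζ)) := by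
    unfold Function.uncurry; fun_prop
  calc _ ≤ ∫⁻ ζ, (∫⁻ ξ, A ξ ^ 2 * k (ξ - ζ)) * ∫⁻ y, k y := by
        gcongr with ζ
        have := lintegral_mul_sq_le (k := fun ξ => k (ξ - ζ)) (by fun_prop) hA
        rwa [lintegral_sub_right_eq_self k ζ] at this
    _ = (∫⁻ ζ, ∫⁻ ξ, A ξ ^ 2 * k (ξ - ζ)) * ∫⁻ y, k y :=
        lintegral_mul_const _ m.lintegral_prod_right'
    _ = (∫⁻ ξ, ∫⁻ ζ, A ξ ^ 2 * k (ξ - ζ)) * ∫⁻ y, k y := by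
        rw [lintegral_lintegral_swap m.aemeasurable]
    _ = (∫⁻ ξ, A ξ ^ 2 * ∫⁻ y, k y) * ∫⁻ y, k y := by
        congr 2 with ξ
        rw [lintegral_const_mul _ (by fun_prop), lintegral_sub_left_eq_self k ξ]
    _ = _ := by rw [lintegral_mul_const _ (by fun_prop)]; ring

/-- The transpose of the convolution with `κ`. -/
def convTranspose (κ : 𝓢(E3, ℂ)) (V : E3 → ℂ) (ζ : E3) : ℂ := ∫ ξ, V ξ * κ (ξ - ζ)

theorem measurable_conv_integrand (κ : 𝓢(E3, ℂ)) {V : E3 → ℂ} (hV : Measurable V) :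
    Measurable (fun p : E3 × E3 => V p.2 * κ (p.2 - p.1)) := by
  have : Measurable κ := κ.continuous.measurable
  fun_prop

theorem measurable_convTranspose (κ : 𝓢(E3, ℂ)) {V : E3 → ℂ} (hV : Measurable V) :
    Measurable (convTranspose κ V) :=
  ((measurable_conv_integrand κ hV).stronglyMeasurable.integral_prod_right'
    (ν := (volume : Measure E3))).measurable

/-- The weighted kernel `(1 + |y|)^{|σ|} |κ(y)|`. -/
def weightedKernel (σ : ℝ) (κ : 𝓢(E3, ℂ)) (y : E3) : ENNReal :=
  ENNReal.ofReal ((1 + ‖y‖) ^ |σ|) * ‖κ y‖ₑ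

/-- The weighted modulus `(1 + |ξ|)^σ |V(ξ)|`. -/
def weightedModulus (σ : ℝ) (V : E3 → ℂ) (ξ : E3) : ENNReal :=
  ENNReal.ofReal ((1 + ‖ξ‖) ^ σ) * ‖V ξ‖ₑ

theorem measurable_weightedKernel (σ : ℝ) (κ : 𝓢(E3, ℂ)) : Measurable (weightedKernel σ κ) := by
  have : Measurable κ := κ.continuous.measurable
  unfold weightedKernel; fun_prop

theorem measurable_weightedModulus (σ : ℝ) {V : E3 → ℂ} (hV : Measurable V) :
    Measurable (weightedModulus σ V) := by
  unfold weightedModulus; fun_prop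

theorem weightedModulus_eq (σ : ℝ) (V : E3 → ℂ) (ξ : E3) :
    weightedModulus σ V ξ = ‖(((1 + ‖ξ‖) ^ σ : ℝ) : ℂ) * V ξ‖ₑ := by
  rw [weightedModulus, enorm_mul, ← ofReal_norm (((1 + ‖ξ‖) ^ σ : ℝ) : ℂ), Complex.norm_real,
    Real.norm_of_nonneg (by positivity)]

theorem weightedL2_iff {σ : ℝ} {V : E3 → ℂ} (hV : Measurable V) :
    WeightedL2 σ V ↔ ∫⁻ ξ, weightedModulus σ V ξ ^ 2 < ⊤ := by
  have hm : Measurable (fun ξ : E3 => (((1 + ‖ξ‖) ^ σ : ℝ) : ℂ) * V ξ) := by fun_prop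
  rw [WeightedL2, MemLp, and_iff_right hm.aestronglyMeasurable,
    eLpNorm_lt_top_iff_lintegral_rpow_enorm_lt_top (by norm_num) (by norm_num)]
  simp [weightedModulus_eq]

theorem lintegral_weightedKernel_lt_top (σ : ℝ) (κ : 𝓢(E3, ℂ)) :
    ∫⁻ y, weightedKernel σ κ y < ⊤ := by
  have hm : Measurable (fun y : E3 => (((1 + ‖y‖) ^ |σ| : ℝ) : ℂ)) := by fun_prop
  have h := ((rapidDecay_schwartz κ).mul_of_bound hm.aestronglyMeasurable (K := 1)
    (N := ⌈|σ|⌉₊) fun y => ?_).integrable.2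
  · rw [hasFiniteIntegral_iff_enorm] at h
    refine lt_of_le_of_lt (lintegral_mono fun y => le_of_eq ?_) h
    rw [weightedKernel, enorm_mul, ← ofReal_norm (((1 + ‖y‖) ^ |σ| : ℝ) : ℂ), Complex.norm_real,
      Real.norm_of_nonneg (by positivity)]
  · rw [Complex.norm_real, Real.norm_of_nonneg (by positivity), one_mul, ← Real.rpow_natCast]
    exact Real.rpow_le_rpow_of_exponent_le (by linarith [norm_nonneg y]) (Nat.le_ceil _)

theorem weight_mul_lintegral_le (σ : ℝ) (κ : 𝓢(E3, ℂ)) (V : E3 → ℂ) (ζ : E3) :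
    ENNReal.ofReal ((1 + ‖ζ‖) ^ σ) * ∫⁻ ξ, ‖V ξ * κ (ξ - ζ)‖ₑ ≤
      ∫⁻ ξ, weightedModulus σ V ξ * weightedKernel σ κ (ξ - ζ) := by
  rw [← lintegral_const_mul' _ _ ENNReal.ofReal_ne_top]
  refine lintegral_mono fun ξ => ?_
  calc ENNReal.ofReal ((1 + ‖ζ‖) ^ σ) * ‖V ξ * κ (ξ - ζ)‖ₑ
      ≤ (ENNReal.ofReal ((1 + ‖ξ‖) ^ σ * (1 + ‖ξ - ζ‖) ^ |σ|)) * (‖V ξ‖ₑ * ‖κ (ξ - ζ)‖ₑ) := by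
        rw [enorm_mul]
        gcongr
        exact one_add_norm_rpow_peetre σ ξ ζ
    _ = _ := by
        rw [ENNReal.ofReal_mul (by positivity), weightedModulus, weightedKernel]; ring

theorem lintegral_conv_weighted_lt_top {σ : ℝ} (κ : 𝓢(E3, ℂ)) {V : E3 → ℂ} (hV : Measurable V)
    (h : WeightedL2 σ V) :
    ∫⁻ ζ, (∫⁻ ξ, weightedModulus σ V ξ * weightedKernel σ κ (ξ - ζ)) ^ 2 < ⊤ := by
  refine lt_of_le_of_lt (lintegral_conv_sq_le (measurable_weightedKernel σ κ)
    (measurable_weightedModulus σ hV)) ?_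
  have h1 := lintegral_weightedKernel_lt_top σ κ
  have h2 := (weightedL2_iff hV).1 h
  exact ENNReal.mul_lt_top (ENNReal.pow_lt_top h1) h2

/-- Peetre's inequality moves the weight onto `V` and the kernel. The weighted kernel is in $L^1$
because `κ` decays rapidly, so Young's inequality applies with any `σ`, negative ones included. -/
theorem weightedL2_convTranspose {σ : ℝ} (κ : 𝓢(E3, ℂ)) {V : E3 → ℂ} (hV : Measurable V)
    (h : WeightedL2 σ V) : WeightedL2 σ (convTranspose κ V) := by
  rw [weightedL2_iff (measurable_convTranspose κ hV)]
  refine lt_of_le_of_lt (lintegral_mono fun ζ => ?_) (lintegral_conv_weighted_lt_top κ hV h)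
  gcongr
  refine le_trans ?_ (weight_mul_lintegral_le σ κ V ζ)
  rw [weightedModulus]
  gcongr
  exact enorm_integral_le_lintegral_enorm _

/-- The weights `σ` on the convolution and `-σ` on `χ` cancel, so the product is controlled by two
finite square integrals. -/
theorem integrable_conv_mul_schwartz {σ : ℝ} (κ χ : 𝓢(E3, ℂ)) {V : E3 → ℂ} (hV : Measurable V)
    (h : WeightedL2 σ V) :
    Integrable (Function.uncurry fun (ζ ξ : E3) => V ξ * κ (ξ - ζ) * χ ζ)
      (volume.prod volume) := by
  have hχ : Measurable χ := χ.continuous.measurable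
  have hm : Measurable (Function.uncurry fun (ζ ξ : E3) => V ξ * κ (ξ - ζ) * χ ζ) :=
    (measurable_conv_integrand κ hV).mul (hχ.comp measurable_fst)
  refine ⟨hm.aestronglyMeasurable, ?_⟩
  rw [hasFiniteIntegral_iff_enorm, lintegral_prod _ hm.enorm.aemeasurable]
  set T : E3 → ENNReal := fun ζ => ∫⁻ ξ, weightedModulus σ V ξ * weightedKernel σ κ (ξ - ζ)
  have hT : ∫⁻ ζ, T ζ ^ 2 < ⊤ := lintegral_conv_weighted_lt_top κ hV h
  have hw : Measurable (fun y : E3 => (((1 + ‖y‖) ^ (-σ) : ℝ) : ℂ)) := by fun_prop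
  have hχ2 : WeightedL2 (-σ) χ := by
    refine RapidDecay.memLp_two ((rapidDecay_schwartz χ).mul_of_bound hw.aestronglyMeasurable
      (K := 1) (N := ⌈-σ⌉₊) fun y => ?_)
    rw [Complex.norm_real, Real.norm_of_nonneg (by positivity), one_mul, ← Real.rpow_natCast]
    exact Real.rpow_le_rpow_of_exponent_le (by linarith [norm_nonneg y]) (Nat.le_ceil _)
  have hχ3 := (weightedL2_iff hχ).1 hχ2
  have amgm : ∀ x y : ENNReal, x * y ≤ x ^ 2 + y ^ 2 := by
    intro x y
    rcases le_total x y with h | h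
    · exact (mul_le_mul' h le_rfl).trans (by rw [← sq]; exact le_add_self)
    · exact (mul_le_mul' le_rfl h).trans (by rw [← sq]; exact le_self_add)
  have mT : Measurable (fun ζ => weightedModulus (-σ) χ ζ ^ 2) :=
    (measurable_weightedModulus _ hχ).pow_const 2
  refine lt_of_le_of_lt (b := ∫⁻ ζ, (T ζ ^ 2 + weightedModulus (-σ) χ ζ ^ 2)) ?_ ?_
  · refine lintegral_mono fun ζ => le_trans (le_of_eq ?_) (le_trans
      (mul_le_mul' (weight_mul_lintegral_le σ κ V ζ) le_rfl) (amgm (T ζ) (weightedModulus (-σ) χ ζ)))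
    simp only [Function.uncurry, enorm_mul _ (χ ζ)]
    rw [lintegral_mul_const' _ _ (by simp), weightedModulus]
    have : ENNReal.ofReal ((1 + ‖ζ‖) ^ σ) * ENNReal.ofReal ((1 + ‖ζ‖) ^ (-σ)) = 1 := by
      rw [← ENNReal.ofReal_mul (by positivity), ← Real.rpow_add (by positivity)]; simp
    calc _ = (ENNReal.ofReal ((1 + ‖ζ‖) ^ σ) * ENNReal.ofReal ((1 + ‖ζ‖) ^ (-σ))) *
          ((∫⁻ ξ, ‖V ξ * κ (ξ - ζ)‖ₑ) * ‖χ ζ‖ₑ) := by rw [this, one_mul]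
      _ = _ := by ring
  · rw [lintegral_add_right _ mT]
    exact ENNReal.add_lt_top.2 ⟨hT, hχ3⟩

theorem fourier_fourier_apply (f : 𝓢(E3, ℂ)) (x : E3) : 𝓕 (𝓕 f) x = f (-x) := by
  have h : 𝓕⁻ (𝓕 f) (-x) = f (-x) := by rw [fourierInv_fourier_eq]
  rw [← h, SchwartzMap.fourierInv_coe, Real.fourierInv_eq_fourier_neg, neg_neg]
  rfl

theorem fourier_pairing_eq_convolution (η ψ : 𝓢(E3, ℂ)) :
    𝓕 (SchwartzMap.pairing (ContinuousLinearMap.mul ℂ ℂ) η ψ) =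
      SchwartzMap.convolution (ContinuousLinearMap.mul ℂ ℂ) (𝓕 η) (𝓕 ψ) := by
  refine schwartz_ext_fourier fun ξ => ?_
  rw [SchwartzMap.fourier_convolution, SchwartzMap.pairing_apply_apply, fourier_fourier_apply,
    fourier_fourier_apply, fourier_fourier_apply, SchwartzMap.pairing_apply_apply]

/-- Multiplication by `η` becomes convolution after the Fourier transform; Fubini transfers it to
`V`. -/
theorem integral_mul_fourier_pairing {σ : ℝ} (η ψ : 𝓢(E3, ℂ)) {V : E3 → ℂ} (hV : Measurable V)
    (h : WeightedL2 σ V) :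
    ∫ ξ, V ξ * 𝓕 (SchwartzMap.pairing (ContinuousLinearMap.mul ℂ ℂ) η ψ) ξ =
      ∫ ζ, convTranspose (𝓕 η) V ζ * 𝓕 ψ ζ := by
  have hi := integrable_conv_mul_schwartz (𝓕 η) (𝓕 ψ) hV h
  calc _ = ∫ ξ, ∫ ζ, V ξ * 𝓕 η (ξ - ζ) * 𝓕 ψ ζ := by
        congr 1 with ξ
        rw [fourier_pairing_eq_convolution, SchwartzMap.convolution_apply, convolution_mul_swap,
          ← integral_const_mul]
        simp_rw [mul_assoc]
    _ = ∫ ζ, ∫ ξ, V ξ * 𝓕 η (ξ - ζ) * 𝓕 ψ ζ := (integral_integral_swap hi).symm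
    _ = _ := by
        congr 1 with ζ
        rw [integral_mul_const, convTranspose]

/-! ### Elliptic regularity on the Fourier side -/

theorem one_add_norm_rpow_le {s : ℝ} (hs0 : 0 < s) (hs1 : s < 1) (ξ : E3) :
    (1 + ‖ξ‖) ^ (2 * s) ≤ 4 + (2 * Real.pi * ‖ξ‖) ^ (2 * s) := by
  have hp := Real.pi_gt_three
  rcases le_total ‖ξ‖ 1 with h | h
  · have h0 : 0 ≤ (2 * Real.pi * ‖ξ‖) ^ (2 * s) := by positivity
    calc (1 + ‖ξ‖) ^ (2 * s) ≤ 2 ^ (2 * s) := by gcongr; linarith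
      _ ≤ 2 ^ (2 : ℝ) := Real.rpow_le_rpow_of_exponent_le (by norm_num) (by linarith)
      _ = 4 := by norm_num
      _ ≤ _ := by linarith
  · calc (1 + ‖ξ‖) ^ (2 * s) ≤ (2 * Real.pi * ‖ξ‖) ^ (2 * s) := by gcongr; nlinarith
      _ ≤ _ := by linarith

/-- The right-hand side of the equation lies in the same weighted space as `V`, while the symbol on
the left dominates $(1+|\xi|)^{2s}$ up to a bounded term. -/
theorem WeightedL2.gain {s k σ : ℝ} (hs0 : 0 < s) (hs1 : s < 1) (κ : 𝓢(E3, ℂ)) {V : E3 → ℂ}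
    (hV : Measurable V)
    (heq : ∀ᵐ ξ, fracSymbol s ξ * V ξ = (k : ℂ) ^ 2 * (V ξ + convTranspose κ V ξ))
    (h : WeightedL2 σ V) : WeightedL2 (σ + 2 * s) V := by
  have h2 := weightedL2_convTranspose κ hV h
  have hg : MemLp (fun ξ => (4 + k ^ 2) * ‖(((1 + ‖ξ‖) ^ σ : ℝ) : ℂ) * V ξ‖ +
      k ^ 2 * ‖(((1 + ‖ξ‖) ^ σ : ℝ) : ℂ) * convTranspose κ V ξ‖) 2 :=
    (h.norm.const_mul _).add (h2.norm.const_mul _)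
  refine hg.mono (by fun_prop) ?_
  filter_upwards [heq] with ξ hξ
  have hw : 0 < 1 + ‖ξ‖ := by positivity
  have hk : ‖(k : ℂ) ^ 2‖ = k ^ 2 := by
    rw [norm_pow, Complex.norm_real, Real.norm_eq_abs, sq_abs]
  have b1 : (1 + ‖ξ‖) ^ (2 * s) * ‖V ξ‖ ≤
      (4 + k ^ 2) * ‖V ξ‖ + k ^ 2 * ‖convTranspose κ V ξ‖ := by
    have e1 : (2 * Real.pi * ‖ξ‖) ^ (2 * s) * ‖V ξ‖ = ‖fracSymbol s ξ * V ξ‖ := by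
      rw [norm_mul, norm_fracSymbol]
    have e2 : ‖fracSymbol s ξ * V ξ‖ ≤ k ^ 2 * (‖V ξ‖ + ‖convTranspose κ V ξ‖) := by
      rw [hξ, norm_mul, hk]
      gcongr
      exact norm_add_le _ _
    have e3 := mul_le_mul_of_nonneg_right (one_add_norm_rpow_le hs0 hs1 ξ) (norm_nonneg (V ξ))
    linarith
  have nn : 0 ≤ (1 + ‖ξ‖) ^ σ := by positivity
  rw [Real.norm_of_nonneg (by positivity)]
  simp only [norm_mul, Complex.norm_real, Real.norm_of_nonneg nn]
  rw [Real.norm_of_nonneg (by positivity), Real.rpow_add hw]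
  calc _ = (1 + ‖ξ‖) ^ σ * ((1 + ‖ξ‖) ^ (2 * s) * ‖V ξ‖) := by ring
    _ ≤ (1 + ‖ξ‖) ^ σ * ((4 + k ^ 2) * ‖V ξ‖ + k ^ 2 * ‖convTranspose κ V ξ‖) := by gcongr
    _ = _ := by ring

theorem WeightedL2.regularity {s k σ : ℝ} (hs0 : 0 < s) (hs1 : s < 1) (κ : 𝓢(E3, ℂ)) {V : E3 → ℂ}
    (hV : Measurable V)
    (heq : ∀ᵐ ξ, fracSymbol s ξ * V ξ = (k : ℂ) ^ 2 * (V ξ + convTranspose κ V ξ))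
    (h : WeightedL2 σ V) (τ : ℝ) : WeightedL2 τ V := by
  have step : ∀ n : ℕ, WeightedL2 (σ + n * (2 * s)) V := by
    intro n
    induction n with
    | zero => simpa using h
    | succ n ih =>
      have := ih.gain hs0 hs1 κ hV heq
      convert this using 1
      push_cast; ring
  -- Each step gains the fixed amount $2s>0$, so finitely many steps pass any target weight.
  obtain ⟨n, hn⟩ := exists_nat_gt ((τ - σ) / (2 * s))
  refine (step n).mono ?_ hV
  rw [div_lt_iff₀ (by linarith)] at hn
  linarith

theorem WeightedL2.locallyIntegrable {σ : ℝ} {V : E3 → ℂ} (h : WeightedL2 σ V) :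
    LocallyIntegrable V := by
  have h1 : LocallyIntegrable (fun ξ => (((1 + ‖ξ‖) ^ σ : ℝ) : ℂ) * V ξ) :=
    MemLp.locallyIntegrable h (by norm_num)
  have c : Continuous (fun ξ : E3 => (((1 + ‖ξ‖) ^ (-σ) : ℝ) : ℂ)) := by
    refine Complex.continuous_ofReal.comp (Continuous.rpow_const (by fun_prop) fun ξ => Or.inl ?_)
    positivity
  have h2 := h1.locallyIntegrableOn Set.univ |>.continuousOn_mul c.continuousOn
    isOpen_univ.isLocallyClosed
  rw [locallyIntegrableOn_univ] at h2
  convert h2 using 1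
  ext ξ
  rw [← mul_assoc, ← Complex.ofReal_mul, ← Real.rpow_add (by positivity)]
  simp

theorem WeightedL2.integrable_mul {σ : ℝ} {V h : E3 → ℂ} (hV : WeightedL2 σ V)
    (hh : RapidDecay h) : Integrable (fun ξ => V ξ * h ξ) := by
  have hw : Measurable (fun y : E3 => (((1 + ‖y‖) ^ (-σ) : ℝ) : ℂ)) := by fun_prop
  have h2 : MemLp (fun ξ => (((1 + ‖ξ‖) ^ (-σ) : ℝ) : ℂ) * h ξ) 2 := by
    refine (hh.mul_of_bound hw.aestronglyMeasurable (K := 1) (N := ⌈-σ⌉₊) fun y => ?_).memLp_two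
    rw [Complex.norm_real, Real.norm_of_nonneg (by positivity), one_mul, ← Real.rpow_natCast]
    exact Real.rpow_le_rpow_of_exponent_le (by linarith [norm_nonneg y]) (Nat.le_ceil _)
  refine (MemLp.integrable_mul hV h2).congr (.of_forall fun ξ => ?_)
  have : ((((1 + ‖ξ‖) ^ σ : ℝ) : ℂ)) * (((1 + ‖ξ‖) ^ (-σ) : ℝ) : ℂ) = 1 := by
    rw [← Complex.ofReal_mul, ← Real.rpow_add (by positivity)]; simp
  calc _ = ((((1 + ‖ξ‖) ^ σ : ℝ) : ℂ) * (((1 + ‖ξ‖) ^ (-σ) : ℝ) : ℂ)) * (V ξ * h ξ) := by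
        simp only [Pi.mul_apply]; ring
    _ = _ := by rw [this, one_mul]

/-- Multiplication by `1 + η`. -/
def mulOneAdd (η ψ : 𝓢(E3, ℂ)) : 𝓢(E3, ℂ) :=
  ψ + SchwartzMap.pairing (ContinuousLinearMap.mul ℂ ℂ) η ψ

theorem mulOneAdd_apply (η ψ : 𝓢(E3, ℂ)) (x : E3) : mulOneAdd η ψ x = (1 + η x) * ψ x := by
  rw [mulOneAdd, add_apply, SchwartzMap.pairing_apply_apply,
    ContinuousLinearMap.mul_apply']
  ring

/-- Every Schwartz function is a Fourier transform, so the weak equation says that a locally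
integrable function annihilates all test functions. -/
theorem ae_eq_of_weak_eq {s k σ : ℝ} (hs0 : 0 < s) (hs1 : s < 1) (η : 𝓢(E3, ℂ)) {V : E3 → ℂ}
    (hV : Measurable V) (hσ : WeightedL2 σ V)
    (hweak : ∀ ψ : 𝓢(E3, ℂ), ∫ ξ, V ξ * (fracSymbol s ξ * 𝓕 ψ ξ) =
      (k : ℂ) ^ 2 * ∫ ξ, V ξ * 𝓕 (mulOneAdd η ψ) ξ) :
    ∀ᵐ ξ, fracSymbol s ξ * V ξ = (k : ℂ) ^ 2 * (V ξ + convTranspose (𝓕 η) V ξ) := by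
  set κ := 𝓕 η with hκ
  have hK := weightedL2_convTranspose κ hV hσ
  -- The symbol grows at most quadratically. This crude loss is enough, since only local
  -- integrability is drawn from it.
  have hsV : WeightedL2 (σ - 2) (fun ξ => fracSymbol s ξ * V ξ) := by
    have hm := measurable_fracSymbol s
    refine MemLp.mono ((MemLp.norm hσ).const_mul ((2 * Real.pi) ^ 2)) (by fun_prop)
      (.of_forall fun ξ => ?_)
    have hb := fracSymbol_bound hs0.le hs1.le ξ
    have hw : 0 < 1 + ‖ξ‖ := by positivity
    simp only [norm_mul, Complex.norm_real, norm_norm]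
    rw [Real.norm_of_nonneg (by positivity), Real.norm_of_nonneg (by positivity),
      Real.norm_of_nonneg (by positivity)]
    calc _ ≤ (1 + ‖ξ‖) ^ (σ - 2) * (((2 * Real.pi) ^ 2 * (1 + ‖ξ‖) ^ 2) * ‖V ξ‖) := by gcongr
      _ = (2 * Real.pi) ^ 2 * (((1 + ‖ξ‖) ^ (σ - 2) * (1 + ‖ξ‖) ^ (2 : ℝ)) * ‖V ξ‖) := by
        rw [Real.rpow_two]; ring
      _ = _ := by rw [← Real.rpow_add hw, sub_add_cancel]
  have hL : LocallyIntegrable fun ξ =>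
      fracSymbol s ξ * V ξ - (k : ℂ) ^ 2 * (V ξ + convTranspose κ V ξ) :=
    hsV.locallyIntegrable.sub ((hσ.locallyIntegrable.add hK.locallyIntegrable).smul ((k : ℂ) ^ 2))
  have h0 := ae_eq_zero_of_integral_mul_schwartz hL fun χ => ?_
  · filter_upwards [h0] with ξ hξ
    exact sub_eq_zero.1 hξ
  obtain ⟨ψ, rfl⟩ : ∃ ψ : 𝓢(E3, ℂ), χ = 𝓕 ψ := ⟨𝓕⁻ χ, (fourier_fourierInv_eq χ).symm⟩
  have i1 : Integrable fun ξ => V ξ * (fracSymbol s ξ * 𝓕 ψ ξ) :=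
    hσ.integrable_mul (rapidDecay_fracSymbol_fourier hs0.le hs1.le ψ)
  have i2 : Integrable fun ξ => V ξ * 𝓕 ψ ξ := hσ.integrable_mul (rapidDecay_schwartz _)
  have i3 : Integrable fun ξ => convTranspose κ V ξ * 𝓕 ψ ξ :=
    hK.integrable_mul (rapidDecay_schwartz _)
  have i4 : Integrable fun ξ => V ξ *
      𝓕 (SchwartzMap.pairing (ContinuousLinearMap.mul ℂ ℂ) η ψ) ξ :=
    hσ.integrable_mul (rapidDecay_schwartz _)
  have e : ∫ ξ, V ξ * 𝓕 (mulOneAdd η ψ) ξ =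
      (∫ ξ, V ξ * 𝓕 ψ ξ) + ∫ ξ, convTranspose κ V ξ * 𝓕 ψ ξ := by
    rw [hκ, ← integral_mul_fourier_pairing η ψ hV hσ, ← integral_add i2 i4]
    congr 1 with ξ
    rw [mulOneAdd, fourier_add_apply, mul_add]
  calc _ = ∫ ξ, (V ξ * (fracSymbol s ξ * 𝓕 ψ ξ) -
        (k : ℂ) ^ 2 * (V ξ * 𝓕 ψ ξ + convTranspose κ V ξ * 𝓕 ψ ξ)) := by
        congr 1 with ξ; ring
    _ = 0 := by
      have i5 : Integrable fun ξ => (k : ℂ) ^ 2 * (V ξ * 𝓕 ψ ξ + convTranspose κ V ξ * 𝓕 ψ ξ) :=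
        (i2.add i3).const_mul _
      rw [integral_sub i1 i5, integral_const_mul, integral_add i2 i3, hweak, e, sub_self]

theorem memHs_fourier {s : ℝ} (hs : 0 ≤ s) (v : Lp ℂ 2 (volume : Measure E3))
    (hv : WeightedL2 s v) : MemHs s (𝓕 v) := by
  set w : E3 → ℂ := fun x => (((1 + ‖x‖ ^ 2) ^ (s / 2) : ℝ) : ℂ) with hw
  have hwt : w.HasTemperateGrowth := by
    rw [hw]; fun_prop
  have hwv : MemLp (fun ξ => w ξ * v ξ) 2 := by
    have hvm := (Lp.aestronglyMeasurable v)
    refine MemLp.mono hv (hwt.1.continuous.aestronglyMeasurable.mul hvm) (.of_forall fun ξ => ?_)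
    rw [norm_mul, norm_mul, Complex.norm_real, Complex.norm_real,
      Real.norm_of_nonneg (by positivity), Real.norm_of_nonneg (by positivity)]
    gcongr
    calc (1 + ‖ξ‖ ^ 2) ^ (s / 2) ≤ ((1 + ‖ξ‖) ^ (2 : ℝ)) ^ (s / 2) := by
          gcongr
          rw [Real.rpow_two]
          nlinarith [norm_nonneg ξ]
      _ = _ := by rw [← Real.rpow_mul (by positivity)]; ring_nf
  refine ⟨𝓕 (hwv.toLp _), ?_⟩
  ext φ
  rw [TemperedDistribution.besselPotential, TemperedDistribution.fourierMultiplierCLM_apply_apply]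
  -- The weight is even, so the two transforms may be interchanged.
  have e1 : 𝓕 (SchwartzMap.smulLeftCLM ℂ w (𝓕⁻ φ)) = 𝓕⁻ (SchwartzMap.smulLeftCLM ℂ w (𝓕 φ)) := by
    ext x
    rw [SchwartzMap.fourierInv_coe, Real.fourierInv_eq_fourier_comp_neg, SchwartzMap.fourier_coe]
    refine congrArg (fun f : E3 → ℂ => 𝓕 f x) (funext fun ξ => ?_)
    rw [SchwartzMap.smulLeftCLM_apply_apply hwt, SchwartzMap.smulLeftCLM_apply_apply hwt]
    simp only [hw, norm_neg]
    congr 1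
  rw [e1, ← TemperedDistribution.fourierInv_apply, Lp.fourierInv_toTemperedDistribution_eq,
    fourierInv_fourier_eq, ← Lp.fourier_toTemperedDistribution_eq,
    TemperedDistribution.fourier_apply, Lp.toTemperedDistribution_apply,
    Lp.toTemperedDistribution_apply]
  refine integral_congr_ae ?_
  filter_upwards [hwv.coeFn_toLp] with ξ hξ
  rw [hξ, SchwartzMap.smulLeftCLM_apply_apply hwt]
  simp only [smul_eq_mul]
  ring

/-- The bootstrap places `V` in $L^2$ with weight `s`, so its Fourier transform is an $H^s$
function. Parseval's formula turns the weak equation into the eigenvalue equation for that function.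
-/
theorem ae_eq_zero_of_zeroNotDirichletEigenvalue {s k σ : ℝ} (hs0 : 0 < s) (hs1 : s < 1)
    {ε : E3 → ℝ} (hspec : ZeroNotDirichletEigenvalue s k ε) (η : 𝓢(E3, ℂ))
    (hη : ∀ x, (ε x : ℂ) = 1 + η x) {V : E3 → ℂ} (hV : Measurable V) (hσ : WeightedL2 σ V)
    (hweak : ∀ ψ : 𝓢(E3, ℂ), ∫ ξ, V ξ * (fracSymbol s ξ * 𝓕 ψ ξ) =
      (k : ℂ) ^ 2 * ∫ ξ, V ξ * 𝓕 (mulOneAdd η ψ) ξ) :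
    V =ᵐ[volume] 0 := by
  have hreg := hσ.regularity hs0 hs1 (𝓕 η) hV (ae_eq_of_weak_eq hs0 hs1 η hV hσ hweak)
  have hV2 : MemLp V 2 := by
    have := hreg 0
    simpa [WeightedL2] using this
  set v : Lp ℂ 2 (volume : Measure E3) := hV2.toLp V with hv
  have hvV : v =ᵐ[volume] V := hV2.coeFn_toLp
  have hvs : WeightedL2 s v := by
    refine (memLp_congr_ae ?_).2 (hreg s)
    filter_upwards [hvV] with ξ hξ
    rw [hξ]
  have pair : ∀ h : E3 → ℂ, RapidDecay h →
      ∫ x, (𝓕 v : Lp ℂ 2 (volume : Measure E3)) x * 𝓕⁻ h x = ∫ ξ, V ξ * h ξ := by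
    intro h hh
    rw [integral_mul_fourierInv _ hh.integrable hh.memLp_two, fourierInv_fourier_eq]
    refine integral_congr_ae ?_
    filter_upwards [hvV] with ξ hξ
    rw [hξ]
  have hz := hspec (𝓕 v) (memHs_fourier hs0.le v hvs) fun φ => ?_
  · have : v = 0 := by
      have h1 : v = 𝓕⁻ (𝓕 v : Lp ℂ 2 (volume : Measure E3)) := (fourierInv_fourier_eq v).symm
      rw [h1, hz]
      exact (Lp.fourierTransformₗᵢ E3 ℂ).symm.map_zero
    have h0 : v =ᵐ[volume] 0 := by
      rw [this]; exact Lp.coeFn_zero _ _ _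
    exact hvV.symm.trans h0
  · have e1 := pair _ (rapidDecay_fracSymbol_fourier hs0.le hs1.le φ)
    have e2 := pair _ (rapidDecay_schwartz (𝓕 (mulOneAdd η φ)))
    rw [fracLaplacian_eq, e1, hweak, ← e2, ← SchwartzMap.fourierInv_coe, fourierInv_fourier_eq]
    congr 1
    refine integral_congr_ae (.of_forall fun x => ?_)
    simp only [mulOneAdd_apply, hη]
    ring

/-! ### The permittivity -/

/-- The Schwartz functions attached to a permittivity `ε`: `η = ε - 1`, `ρ = ε⁻¹ - 1` and
`b = ∇ (log ε)`. -/
structure Medium (ε : E3 → ℝ) (η ρ : 𝓢(E3, ℂ)) (b : Fin 3 → 𝓢(E3, ℂ)) : Prop where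
  eps : ∀ x, (ε x : ℂ) = 1 + η x
  inv : ∀ x, (1 + η x) * (1 + ρ x) = 1
  gradLog : ∀ i x, b i x =
    ((fderiv ℝ (fun y => Real.log (ε y)) x (EuclideanSpace.single i 1) : ℝ) : ℂ)
  compact : ∀ i, HasCompactSupport (b i)
  grad : ∀ i x, dS i η x = (1 + η x) * b i x

theorem fderiv_ofReal_comp {f : E3 → ℝ} {x : E3} (hf : DifferentiableAt ℝ f x) (v : E3) :
    fderiv ℝ (fun y => (f y : ℂ)) x v = ((fderiv ℝ f x v : ℝ) : ℂ) := by
  have h : HasFDerivAt (fun y => (f y : ℂ)) (Complex.ofRealCLM.comp (fderiv ℝ f x)) x :=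
    Complex.ofRealCLM.hasFDerivAt.comp x hf.hasFDerivAt
  rw [h.fderiv]; rfl

theorem AssumptionH.exists_medium {Ω : Set E3} {ε : E3 → ℝ} (h : AssumptionH Ω ε) :
    ∃ η ρ b, Medium ε η ρ b := by
  obtain ⟨c, hc, hcε⟩ := h.lower_bound
  have hpos : ∀ x, 0 < ε x := fun x => hc.trans_le (hcε x)
  have hne : ∀ x, ε x ≠ 0 := fun x => (hpos x).ne'
  have build : ∀ f : E3 → ℝ, ContDiff ℝ ∞ f → (∀ x, x ∉ Ω → f x = 0) →
      ∃ g : 𝓢(E3, ℂ), (∀ x, g x = (f x : ℂ)) ∧ HasCompactSupport g := by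
    intro f hf h0
    have h1 : HasCompactSupport (fun x => (f x : ℂ)) := by
      refine HasCompactSupport.of_support_subset_isCompact h.isBounded.isCompact_closure ?_
      intro x hx
      refine subset_closure ?_
      by_contra hxn
      exact hx (by simp [h0 x hxn])
    have h2 : ContDiff ℝ ∞ (fun x => (f x : ℂ)) := Complex.ofRealCLM.contDiff.comp hf
    exact ⟨h1.toSchwartzMap h2, fun x => rfl, h1⟩
  obtain ⟨η, hη, -⟩ := build (fun x => ε x - 1) (h.smooth.sub contDiff_const)
    fun x hx => by simp [h.eq_one x hx]
  obtain ⟨ρ, hρ, -⟩ := build (fun x => (ε x)⁻¹ - 1) ((h.smooth.inv hne).sub contDiff_const)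
    fun x hx => by simp [h.eq_one x hx]
  -- Outside `Ω` the logarithm vanishes, so $\log\varepsilon_r$, and with it its gradient, has
  -- compact support.
  obtain ⟨L, hL, hLc⟩ := build (fun x => Real.log (ε x)) (h.smooth.log hne)
    fun x hx => by simp [h.eq_one x hx]
  have hdε : ∀ x, DifferentiableAt ℝ ε x := fun x =>
    (h.smooth.differentiable (by simp)).differentiableAt
  have hdL : ∀ x, DifferentiableAt ℝ (fun y => Real.log (ε y)) x := fun x => (hdε x).log (hne x)
  have hb : ∀ i x, dS i L x =
      ((fderiv ℝ (fun y => Real.log (ε y)) x (EuclideanSpace.single i 1) : ℝ) : ℂ) := by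
    intro i x
    rw [dS_apply, show (L : E3 → ℂ) = fun y => ((Real.log (ε y) : ℝ) : ℂ) from funext hL,
      fderiv_ofReal_comp (hdL x)]
  refine ⟨η, ρ, fun i => dS i L, ?_, ?_, hb, ?_, ?_⟩
  · intro x
    rw [hη]; push_cast; ring
  · intro x
    have : (ε x : ℂ) ≠ 0 := by exact_mod_cast hne x
    rw [hη, hρ]
    push_cast
    field_simp
    ring
  · intro i
    exact hLc.mono' (subset_closure.trans (SchwartzMap.tsupport_lineDerivOp_subset _ L))
  · intro i x
    have hη' : (η : E3 → ℂ) = fun y => ((ε y - 1 : ℝ) : ℂ) := funext hη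
    rw [hb, dS_apply, hη', fderiv_ofReal_comp ((hdε x).sub_const 1), fderiv_sub_const,
      fderiv.log (hdε x) (hne x), ← hη']
    have : (ε x : ℂ) ≠ 0 := by exact_mod_cast hne x
    rw [hη]
    simp only [smul_apply, smul_eq_mul]
    push_cast
    field_simp
    ring

/-! ### The weak divergence `∇·E + ∇(log ε)·E` on the Fourier side -/

/-- The Fourier symbol of `∇·u + g`. -/
def fluxSymbol (u : Fin 3 → Lp ℂ 2 (volume : Measure E3)) (g : Lp ℂ 2 (volume : Measure E3))
    (ξ : E3) : ℂ :=
  (𝓕⁻ g : Lp ℂ 2 (volume : Measure E3)) ξ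
    - ∑ i, gradSymbol i ξ * (𝓕⁻ (u i) : Lp ℂ 2 (volume : Measure E3)) ξ

/-- The pairing `⟨∇·u + g, 𝓕⁻h⟩`. -/
def fluxPairing (u : Fin 3 → Lp ℂ 2 (volume : Measure E3)) (g : Lp ℂ 2 (volume : Measure E3))
    (h : E3 → ℂ) : ℂ :=
  (∫ x, g x * 𝓕⁻ h x) - ∑ i, ∫ x, u i x * 𝓕⁻ (fun ξ => gradSymbol i ξ * h ξ) x

theorem measurable_fluxSymbol (u : Fin 3 → Lp ℂ 2 (volume : Measure E3))
    (g : Lp ℂ 2 (volume : Measure E3)) : Measurable (fluxSymbol u g) := by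
  unfold fluxSymbol
  refine (Lp.stronglyMeasurable _).measurable.sub (Finset.measurable_sum _ fun i _ => ?_)
  exact (continuous_gradSymbol i).measurable.mul (Lp.stronglyMeasurable _).measurable

/-- The divergence of an $L^2$ field costs one power of the frequency: this is the starting
regularity $H^{-1}$. -/
theorem weightedL2_fluxSymbol (u : Fin 3 → Lp ℂ 2 (volume : Measure E3))
    (g : Lp ℂ 2 (volume : Measure E3)) : WeightedL2 (-1) (fluxSymbol u g) := by
  have hg := (Lp.memLp (𝓕⁻ g : Lp ℂ 2 (volume : Measure E3))).norm
  have hu := memLp_finsetSum (Finset.univ) fun i (_ : i ∈ Finset.univ) =>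
    ((Lp.memLp (𝓕⁻ (u i) : Lp ℂ 2 (volume : Measure E3))).norm.const_mul (2 * Real.pi))
  have hm := measurable_fluxSymbol u g
  refine MemLp.mono (hg.add hu) (by fun_prop) (.of_forall fun ξ => ?_)
  have hw : 0 < 1 + ‖ξ‖ := by positivity
  have hp := Real.pi_pos
  have b : ‖fluxSymbol u g ξ‖ ≤ (1 + ‖ξ‖) * (‖(𝓕⁻ g : Lp ℂ 2 (volume : Measure E3)) ξ‖ +
      ∑ i, 2 * Real.pi * ‖(𝓕⁻ (u i) : Lp ℂ 2 (volume : Measure E3)) ξ‖) := by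
    rw [mul_add, Finset.mul_sum]
    refine (norm_sub_le _ _).trans (add_le_add ?_ ((norm_sum_le _ _).trans
      (Finset.sum_le_sum fun i _ => ?_)))
    · nlinarith [norm_nonneg ξ, norm_nonneg ((𝓕⁻ g : Lp ℂ 2 (volume : Measure E3)) ξ)]
    · rw [norm_mul, ← mul_assoc]
      gcongr
      refine (norm_gradSymbol_le i ξ).trans ?_
      nlinarith [norm_nonneg ξ]
  rw [norm_mul, Complex.norm_real, Real.norm_of_nonneg (by positivity), Real.rpow_neg_one,
    inv_mul_le_iff₀ hw]
  refine b.trans (mul_le_mul_of_nonneg_left ?_ hw.le)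
  refine le_trans (le_of_eq ?_) (le_abs_self _)
  simp

theorem integrable_mul_fourierInv (u : Lp ℂ 2 (volume : Measure E3)) {h : E3 → ℂ}
    (hh : RapidDecay h) : Integrable fun x => u x * 𝓕⁻ h x :=
  (Lp.memLp u).integrable_mul (memLp_fourierInv hh.integrable hh.memLp_two)

/-- Parseval's formula is applied to each term. The class of admissible `h` includes the singular
ones of the form $|\xi|^{2s-2}\widehat{\nabla\cdot\varphi}$, not only Schwartz functions. -/
theorem fluxPairing_eq (u : Fin 3 → Lp ℂ 2 (volume : Measure E3))
    (g : Lp ℂ 2 (volume : Measure E3)) {h : E3 → ℂ} (hh : RapidDecay h) :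
    fluxPairing u g h = ∫ ξ, fluxSymbol u g ξ * h ξ := by
  have hu : ∀ i, RapidDecay (fun ξ => gradSymbol i ξ * h ξ) := hh.gradSymbol_mul
  have i1 : Integrable fun ξ => (𝓕⁻ g : Lp ℂ 2 (volume : Measure E3)) ξ * h ξ :=
    (Lp.memLp (𝓕⁻ g : Lp ℂ 2 (volume : Measure E3))).integrable_mul hh.memLp_two
  have i2 : ∀ i ∈ Finset.univ, Integrable fun ξ =>
      (𝓕⁻ (u i) : Lp ℂ 2 (volume : Measure E3)) ξ * (gradSymbol i ξ * h ξ) := fun i _ =>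
    (Lp.memLp (𝓕⁻ (u i) : Lp ℂ 2 (volume : Measure E3))).integrable_mul (hu i).memLp_two
  rw [fluxPairing, integral_mul_fourierInv g hh.integrable hh.memLp_two]
  simp only [fun i => integral_mul_fourierInv (u i) (hu i).integrable (hu i).memLp_two]
  rw [← integral_finsetSum _ i2, ← integral_sub i1 (integrable_finsetSum _ i2)]
  congr 1 with ξ
  rw [fluxSymbol, sub_mul, Finset.sum_mul]
  congr 1
  exact Finset.sum_congr rfl fun i _ => by ring

theorem fluxPairing_fourier (u : Fin 3 → Lp ℂ 2 (volume : Measure E3))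
    (g : Lp ℂ 2 (volume : Measure E3)) (ψ : 𝓢(E3, ℂ)) :
    fluxPairing u g (𝓕 ψ : 𝓢(E3, ℂ)) = (∫ x, g x * ψ x) - ∑ i, ∫ x, u i x * dS i ψ x := by
  have h : ∀ i, (fun ξ => gradSymbol i ξ * 𝓕 ψ ξ) = 𝓕 (dS i ψ) := fun i =>
    funext fun ξ => (fourier_dS i ψ ξ).symm
  simp only [fluxPairing, h, ← SchwartzMap.fourierInv_coe, fourierInv_fourier_eq]

/-- All moments of `h` are integrable. Smoothness is used to multiply the potential by a compactly
supported coefficient and obtain a Schwartz function. -/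
theorem contDiff_fourierInv_of_rapidDecay {h : E3 → ℂ} (hh : RapidDecay h) :
    ContDiff ℝ ∞ (𝓕⁻ h) := by
  have e : 𝓕⁻ h = fun x => 𝓕 h (-x) := funext fun x => Real.fourierInv_eq_fourier_neg h x
  have hc : ContDiff ℝ ∞ (𝓕 h) := by
    refine Real.contDiff_fourier fun n _ => ?_
    have hm : RapidDecay (fun ξ => ((‖ξ‖ ^ n : ℝ) : ℂ) * h ξ) := by
      refine hh.mul_of_bound (K := 1) (N := n) ?_ fun ξ => ?_
      · exact Continuous.aestronglyMeasurable (by fun_prop)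
      · rw [Complex.norm_real, Real.norm_of_nonneg (by positivity), one_mul]
        gcongr
        linarith
    refine hm.integrable.norm.congr (.of_forall fun ξ => ?_)
    simp only
    rw [norm_mul, Complex.norm_real, Real.norm_of_nonneg (by positivity)]
  rw [e]
  exact hc.comp contDiff_neg

/-! ### The two equations in terms of the flux -/

/-- The Schwartz function `η ψ`. -/
def mulS (η ψ : 𝓢(E3, ℂ)) : 𝓢(E3, ℂ) :=
  SchwartzMap.pairing (ContinuousLinearMap.mul ℂ ℂ) η ψ

theorem mulS_apply (η ψ : 𝓢(E3, ℂ)) (x : E3) : mulS η ψ x = η x * ψ x := by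
  rw [mulS, SchwartzMap.pairing_apply_apply, ContinuousLinearMap.mul_apply']

theorem dS_mulS (i : Fin 3) (η ψ : 𝓢(E3, ℂ)) (x : E3) :
    dS i (mulS η ψ) x = dS i η x * ψ x + η x * dS i ψ x := by
  have : (mulS η ψ : E3 → ℂ) = fun y => η y * ψ y := funext (mulS_apply η ψ)
  rw [dS_apply, dS_apply, dS_apply, this, fderiv_fun_mul η.differentiableAt ψ.differentiableAt]
  simp only [add_apply, smul_apply, smul_eq_mul]
  ring

theorem dS_mulOneAdd (i : Fin 3) (η ψ : 𝓢(E3, ℂ)) (x : E3) :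
    dS i (mulOneAdd η ψ) x = dS i η x * ψ x + (1 + η x) * dS i ψ x := by
  have : dS i (mulOneAdd η ψ) = dS i ψ + dS i (mulS η ψ) :=
    LineDeriv.lineDerivOp_add _ _ _
  rw [this, add_apply, dS_mulS]
  ring

theorem fieldPairing_fieldOf (u : Fin 3 → Lp ℂ 2 (volume : Measure E3)) {f : VecField}
    (hf : ∀ i, MemLp (fun x => f x i) 2) :
    fieldPairing (fieldOf u) f = ∑ i, ∫ x, u i x * f x i := by
  rw [fieldPairing]
  exact integral_finsetSum _ fun i _ => (Lp.memLp (u i)).integrable_mul (hf i)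

theorem exists_schwartzMap_eq_smooth_mul {b : 𝓢(E3, ℂ)} (hb : HasCompactSupport b) {q : E3 → ℂ}
    (hq : ContDiff ℝ ∞ q) : ∃ χ : 𝓢(E3, ℂ), ∀ x, χ x = b x * q x := by
  have h1 : HasCompactSupport (fun x => b x * q x) := hb.mul_right
  have h2 : ContDiff ℝ ∞ (fun x => b x * q x) := (b.smooth ⊤).mul hq
  exact ⟨h1.toSchwartzMap h2, fun x => rfl⟩

theorem memLp_bounded_mul_schwartz {e : E3 → ℂ} (he : Continuous e) {M : ℝ}
    (hM : ∀ x, ‖e x‖ ≤ M) (ψ : 𝓢(E3, ℂ)) : MemLp (fun x => e x * ψ x) 2 := by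
  refine MemLp.mono ((ψ.memLp 2).norm.const_mul M)
    (he.mul ψ.continuous).aestronglyMeasurable (.of_forall fun x => ?_)
  have hM0 : 0 ≤ M := (norm_nonneg _).trans (hM x)
  rw [norm_mul, norm_mul, norm_norm, Real.norm_of_nonneg hM0]
  gcongr
  exact hM x

theorem integrable_bounded_mul_schwartz {e : E3 → ℂ} (he : Continuous e) {M : ℝ}
    (hM : ∀ x, ‖e x‖ ≤ M) (ψ : 𝓢(E3, ℂ)) : Integrable (fun x => e x * ψ x) :=
  ψ.integrable.bdd_mul (c := M) he.aestronglyMeasurable (.of_forall hM)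

theorem memLp_schwartz_mul_Lp (b : 𝓢(E3, ℂ)) (u : Lp ℂ 2 (volume : Measure E3)) :
    MemLp (fun x => b x * u x) 2 := by
  obtain ⟨C, hC⟩ := schwartz_one_add_norm_pow_bound b 0
  simp only [pow_zero, one_mul] at hC
  refine MemLp.mono ((Lp.memLp u).norm.const_mul C)
    (b.continuous.aestronglyMeasurable.mul (Lp.aestronglyMeasurable u)) (.of_forall fun x => ?_)
  have hC0 : 0 ≤ C := (norm_nonneg _).trans (hC x)
  rw [norm_mul, norm_mul, norm_norm, Real.norm_of_nonneg hC0]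
  gcongr
  exact hC x

/-- A distribution `T` given on Schwartz fields by the bounded continuous function `e`,
and annihilating gradients. -/
structure IsBoundedField (T : VecPairing) (e : Fin 3 → E3 → ℂ) (M : ℝ) : Prop where
  cont : ∀ j, Continuous (e j)
  bdd : ∀ j x, ‖e j x‖ ≤ M
  eq : ∀ φ : Fin 3 → 𝓢(E3, ℂ), T (testField φ) = ∑ j, ∫ x, e j x * φ j x
  grad : ∀ ψ : 𝓢(E3, ℂ), T (testField (gradS ψ)) = 0

/-- The zeroth-order terms `⟨ε Es, φ⟩ + ⟨(ε - 1) Ei, φ⟩`. -/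
def zerothOrder (u : Fin 3 → Lp ℂ 2 (volume : Measure E3)) (e : Fin 3 → E3 → ℂ) (η : 𝓢(E3, ℂ))
    (φ : Fin 3 → 𝓢(E3, ℂ)) : ℂ :=
  (∑ i, ∫ x, u i x * mulOneAdd η (φ i) x) + ∑ i, ∫ x, e i x * mulS η (φ i) x

section equations

variable {s : ℝ} {ε : E3 → ℝ} {η ρ : 𝓢(E3, ℂ)} {b : Fin 3 → 𝓢(E3, ℂ)} {T : VecPairing}
  {e : Fin 3 → E3 → ℂ} {M : ℝ}

theorem mulDist_add_mulDist (hm : Medium ε η ρ b) (hT : IsBoundedField T e M)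
    (u : Fin 3 → Lp ℂ 2 (volume : Measure E3)) (φ : Fin 3 → 𝓢(E3, ℂ)) :
    mulDist ε (fieldPairing (fieldOf u)) (testField φ) +
      mulDist (fun x => ε x - 1) T (testField φ) = zerothOrder u e η φ := by
  have e1 : (fun x i => (ε x : ℂ) * testField φ x i) =
      testField (fun i => mulOneAdd η (φ i)) := by
    ext x i
    simp only [testField, mulOneAdd_apply, hm.eps]
  have e2 : (fun x i => ((ε x - 1 : ℝ) : ℂ) * testField φ x i) =
      testField (fun i => mulS η (φ i)) := by
    ext x i
    simp only [testField, mulS_apply, Complex.ofReal_sub, hm.eps, Complex.ofReal_one]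
    ring
  rw [mulDist, mulDist, e1, e2, hT.eq,
    fieldPairing_fieldOf u fun i => (mulOneAdd η (φ i)).memLp 2]
  rfl

/-- The total field enters through $\nabla(\log\varepsilon_r)\cdot(\widetilde E_s+\widetilde E_i)$.
The incident part is merely bounded, but the decay of `b` brings the product into $L^2$. -/
theorem exists_lowerOrder_source (hT : IsBoundedField T e M)
    (u : Fin 3 → Lp ℂ 2 (volume : Measure E3)) (b : Fin 3 → 𝓢(E3, ℂ)) :
    ∃ g : Lp ℂ 2 (volume : Measure E3),
      ∀ᵐ x, g x = ∑ i, (u i x * b i x + e i x * b i x) := by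
  have hg : MemLp (fun x => ∑ i, (u i x * b i x + e i x * b i x)) 2 := by
    refine memLp_finsetSum _ fun i _ => MemLp.add ?_ ?_
    · simpa only [mul_comm] using memLp_schwartz_mul_Lp (b i) (u i)
    · exact memLp_bounded_mul_schwartz (hT.cont i) (hT.bdd i) (b i)
  exact ⟨hg.toLp _, hg.coeFn_toLp⟩

theorem lowerOrderDist_add (hs0 : 0 < s) (hs1 : s < 1) (hm : Medium ε η ρ b)
    (hT : IsBoundedField T e M) (u : Fin 3 → Lp ℂ 2 (volume : Measure E3))
    {g : Lp ℂ 2 (volume : Measure E3)} (hg : ∀ᵐ x, g x = ∑ i, (u i x * b i x + e i x * b i x))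
    (φ : Fin 3 → 𝓢(E3, ℂ)) :
    lowerOrderDist s ε (fieldPairing (fieldOf u)) (testField φ) +
        lowerOrderDist s ε T (testField φ) =
      ∫ x, g x * 𝓕⁻ (fun ξ => fracSymbol (s - 1) ξ * 𝓕 (divS φ) ξ) x := by
  have hh : RapidDecay (fun ξ => fracSymbol (s - 1) ξ * 𝓕 (divS φ) ξ) :=
    (vanishingDecay_fourier_divS φ).fracSymbol_mul (by linarith) (by linarith)
  set q := 𝓕⁻ (fun ξ => fracSymbol (s - 1) ξ * 𝓕 (divS φ) ξ) with hq
  have hqr : rieszPotential (2 - 2 * s) (divField (testField φ)) = q := by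
    rw [divField_testField, rieszPotential, show -((2 - 2 * s) / 2) = s - 1 by ring,
      fracLaplacian_eq]
  -- The potential itself need not be Schwartz. The compact support of `b` makes the product a test
  -- field, on which `T` is known to be given by `e`.
  choose χ hχ using fun i => exists_schwartzMap_eq_smooth_mul (hm.compact i) (contDiff_fourierInv_of_rapidDecay hh)
  have e1 : (fun x i => ((fderiv ℝ (fun y => Real.log (ε y)) x (EuclideanSpace.single i 1) : ℝ) : ℂ)
      * rieszPotential (2 - 2 * s) (divField (testField φ)) x) = testField χ := by
    ext x i
    rw [hqr, testField, hχ, hm.gradLog]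
  have i1 : ∀ i ∈ Finset.univ, Integrable fun x => u i x * χ i x := fun i _ =>
    (Lp.memLp (u i)).integrable_mul ((χ i).memLp 2)
  have i2 : ∀ i ∈ Finset.univ, Integrable fun x => e i x * χ i x := fun i _ =>
    integrable_bounded_mul_schwartz (hT.cont i) (hT.bdd i) (χ i)
  rw [lowerOrderDist, lowerOrderDist, e1, hT.eq,
    fieldPairing_fieldOf u fun i => (χ i).memLp 2]
  simp only [testField]
  rw [← integral_finsetSum _ i1, ← integral_finsetSum _ i2,
    ← integral_add (integrable_finsetSum _ i1) (integrable_finsetSum _ i2)]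
  refine integral_congr_ae ?_
  filter_upwards [hg] with x hx
  rw [hx, Finset.sum_mul, ← Finset.sum_add_distrib]
  refine Finset.sum_congr rfl fun i _ => ?_
  rw [hχ]
  ring

theorem fracLaplacianDist_sub_rieszCurlCurlDist (hs0 : 0 < s) (hs1 : s < 1)
    (u : Fin 3 → Lp ℂ 2 (volume : Measure E3)) (φ : Fin 3 → 𝓢(E3, ℂ)) :
    fracLaplacianDist s (fieldPairing (fieldOf u)) (testField φ) -
        rieszCurlCurlDist s (fieldPairing (fieldOf u)) (testField φ) =
      -∑ i, ∫ x, u i x *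
        𝓕⁻ (fun ξ => gradSymbol i ξ * (fracSymbol (s - 1) ξ * 𝓕 (divS φ) ξ)) x := by
  have h1 : ∀ i, RapidDecay (fun ξ => fracSymbol s ξ * 𝓕 (φ i) ξ) := fun i =>
    rapidDecay_fracSymbol_fourier hs0.le hs1.le (φ i)
  have h2 : ∀ i, RapidDecay (fun ξ => fracSymbol (s - 1) ξ * 𝓕 (curlS (curlS φ) i) ξ) := fun i =>
    (vanishingDecay_fourier_curlS _ i).fracSymbol_mul (by linarith) (by linarith)
  have e1 : fracLaplacianVec s (testField φ) =
      fun x i => 𝓕⁻ (fun ξ => fracSymbol s ξ * 𝓕 (φ i) ξ) x := rfl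
  have e2 : rieszPotentialVec (2 - 2 * s) (curlField (curlField (testField φ))) =
      fun x i => 𝓕⁻ (fun ξ => fracSymbol (s - 1) ξ * 𝓕 (curlS (curlS φ) i) ξ) x := by
    rw [curlField_testField, curlField_testField]
    ext x i
    rw [rieszPotentialVec, rieszPotential, show -((2 - 2 * s) / 2) = s - 1 by ring]
    rfl
  rw [fracLaplacianDist, rieszCurlCurlDist, e1, e2,
    fieldPairing_fieldOf u fun i => memLp_fourierInv (h1 i).integrable (h1 i).memLp_two,
    fieldPairing_fieldOf u fun i => memLp_fourierInv (h2 i).integrable (h2 i).memLp_two,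
    ← Finset.sum_sub_distrib, ← Finset.sum_neg_distrib]
  refine Finset.sum_congr rfl fun i _ => ?_
  rw [← integral_sub (integrable_mul_fourierInv (u i) (h1 i))
    (integrable_mul_fourierInv (u i) (h2 i)), ← integral_neg]
  congr 1 with x
  have := congrFun (fourierInv_sub_of_integrable (h1 i).integrable (h2 i).integrable) x
  rw [← mul_sub, ← this]
  simp only [fracSymbol_curl_curl hs0]
  rw [← mul_neg]
  congr 1
  simp only [Real.fourierInv_eq, smul_neg, integral_neg]

/-- This is $\nabla\cdot\big(\varepsilon_r\widetilde E_s+(\varepsilon_r-1)\widetilde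
E_i\big)=\varepsilon_rv$: the product rule with
$\nabla\varepsilon_r=\varepsilon_r\nabla\log\varepsilon_r$ gives the coefficient terms, and
$\nabla\cdot\widetilde E_i=0$ removes the derivative of the incident field. -/
theorem zerothOrder_gradS (hm : Medium ε η ρ b) (hT : IsBoundedField T e M)
    (u : Fin 3 → Lp ℂ 2 (volume : Measure E3)) {g : Lp ℂ 2 (volume : Measure E3)}
    (hg : ∀ᵐ x, g x = ∑ i, (u i x * b i x + e i x * b i x)) (ψ : 𝓢(E3, ℂ)) :
    zerothOrder u e η (gradS ψ) = -fluxPairing u g (𝓕 (mulOneAdd η ψ) : 𝓢(E3, ℂ)) := by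
  have d1 : ∀ i x, dS i (mulOneAdd η ψ) x = b i x * mulOneAdd η ψ x + mulOneAdd η (dS i ψ) x := by
    intro i x
    rw [dS_mulOneAdd, mulOneAdd_apply, mulOneAdd_apply, hm.grad]; ring
  have d2 : ∀ i x, dS i (mulS η ψ) x = b i x * mulOneAdd η ψ x + mulS η (dS i ψ) x := by
    intro i x
    rw [dS_mulS, mulOneAdd_apply, mulS_apply, hm.grad]; ring
  have i1 : ∀ i ∈ Finset.univ, Integrable fun x => u i x * mulS (b i) (mulOneAdd η ψ) x :=
    fun i _ => (Lp.memLp (u i)).integrable_mul ((mulS (b i) _).memLp 2)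
  have i2 : ∀ i ∈ Finset.univ, Integrable fun x => e i x * mulS (b i) (mulOneAdd η ψ) x :=
    fun i _ => integrable_bounded_mul_schwartz (hT.cont i) (hT.bdd i) _
  have i3 : ∀ i, Integrable fun x => u i x * mulOneAdd η (dS i ψ) x :=
    fun i => (Lp.memLp (u i)).integrable_mul ((mulOneAdd η _).memLp 2)
  have i4 : ∀ i, Integrable fun x => e i x * mulS η (dS i ψ) x :=
    fun i => integrable_bounded_mul_schwartz (hT.cont i) (hT.bdd i) _
  have h0 := hT.grad (mulS η ψ)
  rw [hT.eq] at h0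
  have h1 : ∑ i, ∫ x, e i x * dS i (mulS η ψ) x =
      (∑ i, ∫ x, e i x * mulS (b i) (mulOneAdd η ψ) x) + ∑ i, ∫ x, e i x * mulS η (dS i ψ) x := by
    rw [← Finset.sum_add_distrib]
    refine Finset.sum_congr rfl fun i hi => ?_
    rw [← integral_add (i2 i hi) (i4 i)]
    congr 1 with x
    rw [d2, mulS_apply (b i)]; ring
  have h2 : ∑ i, ∫ x, u i x * dS i (mulOneAdd η ψ) x =
      (∑ i, ∫ x, u i x * mulS (b i) (mulOneAdd η ψ) x) +
        ∑ i, ∫ x, u i x * mulOneAdd η (dS i ψ) x := by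
    rw [← Finset.sum_add_distrib]
    refine Finset.sum_congr rfl fun i hi => ?_
    rw [← integral_add (i1 i hi) (i3 i)]
    congr 1 with x
    rw [d1, mulS_apply (b i)]; ring
  have h3 : ∫ x, g x * mulOneAdd η ψ x =
      (∑ i, ∫ x, u i x * mulS (b i) (mulOneAdd η ψ) x) +
        ∑ i, ∫ x, e i x * mulS (b i) (mulOneAdd η ψ) x := by
    rw [← integral_finsetSum _ i1, ← integral_finsetSum _ i2,
      ← integral_add (integrable_finsetSum _ i1) (integrable_finsetSum _ i2)]
    refine integral_congr_ae ?_
    filter_upwards [hg] with x hx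
    rw [hx, Finset.sum_mul, ← Finset.sum_add_distrib]
    refine Finset.sum_congr rfl fun i _ => ?_
    rw [mulS_apply (b i)]
    ring
  have h0' : ∑ i, ∫ x, e i x * dS i (mulS η ψ) x = 0 := h0
  rw [h1] at h0'
  rw [fluxPairing_fourier, h2, h3, zerothOrder]
  simp only [gradS]
  linear_combination h0'

theorem rieszCurlCurlDist_gradS (T : VecPairing) (ψ : 𝓢(E3, ℂ)) (hT : T (testField 0) = 0) :
    rieszCurlCurlDist s T (testField (gradS ψ)) = 0 := by
  rw [rieszCurlCurlDist, curlField_testField, curlField_testField, curlS_gradS]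
  have hc : curlS (0 : Fin 3 → 𝓢(E3, ℂ)) = 0 := by
    ext1 i
    refine schwartz_ext_fourier fun ξ => ?_
    rw [fourier_curlS, Pi.zero_apply, FourierTransform.fourier_zero]
    fin_cases i <;> simp
  have : rieszPotentialVec (2 - 2 * s) (testField 0) = testField 0 := by
    ext x i
    have h : rieszPotentialVec (2 - 2 * s) (testField 0) x i =
      fracLaplacian (-((2 - 2 * s) / 2)) (0 : 𝓢(E3, ℂ)) x := rfl
    rw [h, fracLaplacian_eq, FourierTransform.fourier_zero]
    simp [Real.fourierInv_eq, testField]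
  rw [hc, this, hT]

/-- Here $(-\Delta)^{s-1}\nabla\cdot\nabla=-(-\Delta)^s$. -/
theorem fluxPairing_divS_gradS (hs0 : 0 < s) (u : Fin 3 → Lp ℂ 2 (volume : Measure E3))
    (g : Lp ℂ 2 (volume : Measure E3)) (ψ : 𝓢(E3, ℂ)) :
    (∫ ξ, fluxSymbol u g ξ * (fracSymbol (s - 1) ξ * 𝓕 (divS (gradS ψ)) ξ)) =
      -∫ ξ, fluxSymbol u g ξ * (fracSymbol s ξ * 𝓕 ψ ξ) := by
  rw [← integral_neg]
  congr 1 with ξ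
  have h := gradSymbol_sq_sum ξ
  rw [fracSymbol_eq hs0, fourier_divS]
  simp only [gradS, fourier_dS]
  linear_combination fluxSymbol u g ξ * fracSymbol (s - 1) ξ * 𝓕 ψ ξ * h

end equations

theorem isBoundedField_incidentField {s k : ℝ} (hs0 : 0 < s) (hs1 : s < 1) (hk : 0 < k)
    (p d : E3) : ∃ e M, IsBoundedField (incidentField s k p d) e M := by
  obtain ⟨e, hc, ⟨M, hM⟩, he⟩ := exists_incidentField_eq hs0 hs1 hk p d
  exact ⟨e, M, hc, hM, he, incidentField_gradS s k p d⟩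

end

/-! ### Equivalence of the two equations -/

theorem mainTheorem8 (s k : ℝ) (hs0 : 0 < s) (hs1 : s < 1) (hk : 0 < k)
    (Ω : Set E3) (ε : E3 → ℝ) (hε : AssumptionH Ω ε)
    (hspec : ZeroNotDirichletEigenvalue s k ε)
    (p d : E3)
    (Es : Fin 3 → Lp ℂ 2 (volume : Measure E3)) (hEs : ∀ i, MemHs s (Es i)) :
    SolvesOnePoint s k ε (fieldPairing (fieldOf Es)) (incidentField s k p d) ↔
      SolvesFracLaplace s k ε (fieldPairing (fieldOf Es)) (incidentField s k p d) := by
  obtain ⟨η, ρ, b, hm⟩ := hε.exists_medium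
  obtain ⟨e, M, hT⟩ := isBoundedField_incidentField hs0 hs1 hk p d
  obtain ⟨g, hg⟩ := exists_lowerOrder_source hT Es b
  set V := fluxSymbol Es g with hVdef
  have hV : Measurable V := measurable_fluxSymbol Es g
  have hV1 : WeightedL2 (-1) V := weightedL2_fluxSymbol Es g
  have hk2 : (k : ℂ) ^ 2 ≠ 0 := pow_ne_zero _ (by exact_mod_cast hk.ne')
  have flux : ∀ h, RapidDecay h → fluxPairing Es g h = ∫ ξ, V ξ * h ξ := fun h hh =>
    fluxPairing_eq Es g hh
  have hdiv : ∀ φ, RapidDecay (fun ξ => fracSymbol (s - 1) ξ * 𝓕 (divS φ) ξ) := fun φ =>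
    (vanishingDecay_fourier_divS φ).fracSymbol_mul (by linarith) (by linarith)
  have one : SolvesOnePoint s k ε (fieldPairing (fieldOf Es)) (incidentField s k p d) ↔
      ∀ φ, rieszCurlCurlDist s (fieldPairing (fieldOf Es)) (testField φ) =
        (k : ℂ) ^ 2 * zerothOrder Es e η φ := by
    refine forall_congr' fun φ => ?_
    rw [← mulDist_add_mulDist hm hT Es φ, sub_eq_iff_eq_add, mul_add, add_comm]
  -- In this form the second equation is the first one plus a single term that is linear in the
  -- flux.
  have two : SolvesFracLaplace s k ε (fieldPairing (fieldOf Es)) (incidentField s k p d) ↔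
      ∀ φ, rieszCurlCurlDist s (fieldPairing (fieldOf Es)) (testField φ) +
        ∫ ξ, V ξ * (fracSymbol (s - 1) ξ * 𝓕 (divS φ) ξ) =
          (k : ℂ) ^ 2 * zerothOrder Es e η φ := by
    refine forall_congr' fun φ => ?_
    have h1 := lowerOrderDist_add hs0 hs1 hm hT Es hg φ
    have h2 := fracLaplacianDist_sub_rieszCurlCurlDist hs0 hs1 Es φ
    have h3 := flux _ (hdiv φ)
    have h4 := mulDist_add_mulDist hm hT Es φ
    rw [fluxPairing] at h3
    constructor
    · intro h
      linear_combination h + h1.symm + h2.symm + h3.symm + (k : ℂ) ^ 2 * h4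
    · intro h
      linear_combination h + h1 + h2 + h3 - (k : ℂ) ^ 2 * h4
  have zero : ∀ ψ, rieszCurlCurlDist s (fieldPairing (fieldOf Es)) (testField (gradS ψ)) = 0 :=
    fun ψ => rieszCurlCurlDist_gradS _ ψ (by simp [fieldPairing, testField])
  have fluxε : ∀ ψ, zerothOrder Es e η (gradS ψ) = -∫ ξ, V ξ * 𝓕 (mulOneAdd η ψ) ξ := fun ψ => by
    rw [zerothOrder_gradS hm hT Es hg, flux _ (rapidDecay_schwartz _)]
  have conclude : V =ᵐ[volume] 0 → ∀ φ : Fin 3 → 𝓢(E3, ℂ),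
      ∫ ξ, V ξ * (fracSymbol (s - 1) ξ * 𝓕 (divS φ) ξ) = 0 := by
    intro h0 φ
    rw [← integral_zero E3 ℂ]
    refine integral_congr_ae ?_
    filter_upwards [h0] with ξ hξ
    rw [hξ, Pi.zero_apply, zero_mul]
  rw [one, two]
  constructor
  · intro h φ
    rw [conclude _ φ, add_zero, h φ]
    refine ae_eq_zero_of_integral_mul_schwartz hV1.locallyIntegrable fun χ => ?_
    -- Since $\varepsilon_r$ is invertible among multipliers of test functions, every `χ` is the
    -- transform of $\varepsilon_r\psi$ with $\psi=\varepsilon_r^{-1}\mathcal F^{-1}\chi$.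
    have hχ : 𝓕 (mulOneAdd η (mulOneAdd ρ (𝓕⁻ χ))) = χ := by
      have : mulOneAdd η (mulOneAdd ρ (𝓕⁻ χ)) = 𝓕⁻ χ := by
        ext x
        rw [mulOneAdd_apply, mulOneAdd_apply, ← mul_assoc, hm.inv, one_mul]
      rw [this, fourier_fourierInv_eq]
    have h1 := h (gradS (mulOneAdd ρ (𝓕⁻ χ)))
    rw [zero, fluxε, hχ] at h1
    simpa [hk.ne'] using h1.symm
  · intro h φ
    have h0 := conclude (ae_eq_zero_of_zeroNotDirichletEigenvalue hs0 hs1 hspec η hm.eps hV hV1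
      fun ψ => ?_) φ
    · rw [← h φ, h0, add_zero]
    · have h1 := h (gradS ψ)
      rw [zero, fluxε, fluxPairing_divS_gradS hs0 Es g ψ] at h1
      linear_combination -h1
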